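/- **Conventions.** Fix real numbers $F\ge 1$, $K\ge 0$, $G\ge 1$, $H\ge 2$. All C*-algebras and *-morphisms are unital; inner products are linear in the second variable. For a C*-algebra $A$ write $\mathfrak{sa}(A)$ for its self-adjoint part, $S(A)$ for its state space, $\Re a=\frac{a+a^*}{2}$, $\Im a=\frac{a-a^*}{2i}$. A seminorm defined on a subspace is extended by $\infty$ off this subspace. For $N:E\to[0,\infty]$ and functionals $\varphi,\psi:E\to\mathbb C$ let $\mathsf{mk}_N(\varphi,\psi)=\sup\{|\varphi(x)-\psi(x)|:N(x)\le1\}$, and for families indexed by the same set $J$ let $\mathsf{mk}_N((\varphi_j)_j,(\psi_j)_j)=\sup_{j}\mathsf{mk}_N(\varphi_j,\psi_j)$. $\mathrm{Haus}_d(X,Y)=\max\{\mathrm{Haus}_d(X\to Y),\mathrm{Haus}_d(Y\to X)\}$ with $\mathrm{Haus}_d(X\to Y)=\sup_{x\in X}\inf_{y\in Y}d(x,y)$. **Quantum compact metric spaces.** $(A,L)$ is a quantum compact metric space if $L$ is a seminorm on a dense subspace $\mathrm{dom}(L)$ of $\mathfrak{sa}(A)$ with $L(1)=0$, such that $\mathsf{mk}_L$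 is a metric on $S(A)$ inducing the weak* topology, $\max\{L(\Re(ab)),L(\Im(ab))\}\le F(L(a)\|b\|+\|a\|L(b))+K L(a)L(b)$ for all $a,b\in\mathrm{dom}(L)$, and $\{L\le1\}$ is closed. **Metrical C*-correspondences.** A metrical C*-correspondence $(M,\mathsf D,A,L,B,Q)$ consists of quantum compact metric spaces $(A,L)$, $(B,Q)$, a right Hilbert $B$-module $M$ with a unital *-morphism from $A$ to the adjointable operators on $M$, and a norm $\mathsf D\ge\|\cdot\|_M$ on a dense complex subspace of $M$ such that $\{\mathsf D\le1\}$ is compact in $M$, $\mathsf D(a\omega)\le G(\|a\|+L(a))\mathsf D(\omega)$ and $\max\{Q(\Re\langle\omega,\eta\rangle),Q(\Im\langle\omega,\eta\rangle)\}\le H\,\mathsf D(\omega)\mathsf D(\eta)$ for $a\in\mathrm{dom}(L)$, $\omega,\eta\in\mathrm{dom}(\mathsf D)$. A *modular quantum isometry* $(\Pi,\pi,\theta)$ from $(M_1,\mathsf D_1,A_1,L_1,B_1,Q_1)$ to $(M_2,\mathsf D_2,A_2,L_2,B_2,Q_2)$ consists of a continuous linear map $\Pi:M_1\to M_2$ and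 unital *-morphisms $\pi:A_1\to A_2$, $\theta:B_1\to B_2$ with $\Pi(a\omega)=\pi(a)\Pi(\omega)$, $\Pi(\omega b)=\Pi(\omega)\theta(b)$, $\theta(\langle\omega,\eta\rangle)=\langle\Pi(\omega),\Pi(\eta)\rangle$, mapping the domains of $\mathsf D_1,L_1,Q_1$ into those of $\mathsf D_2,L_2,Q_2$, and such that $\mathsf D_2,L_2,Q_2$ are on their domains the quotients of $\mathsf D_1,L_1,Q_1$: $\mathsf D_2(\omega)=\inf\{\mathsf D_1(\eta):\Pi(\eta)=\omega\}$, and similarly for $L_2$ (with $\pi$) and $Q_2$ (with $\theta$). **Tunnels.** A tunnel $\tau$ from $\mathbb M_1$ to $\mathbb M_2$ is a metrical C*-correspondence $\mathbb P=(P,\mathsf T,D,L_D,E,L_E)$ with modular quantum isometries $(\Pi_j,\pi_j,\theta_j):\mathbb P\to\mathbb M_j$, $j=1,2$. Its extent $\chi(\tau)$ is the maximum over $j\in\{1,2\}$ of $\mathrm{Haus}_{\mathsf{mk}_{L_D}}(\{\varphi\circ\pi_j:\varphi\in S(A_j)\},S(D))$ and $\mathrm{Haus}_{\mathsf{mk}_{L_E}}(\{\psi\circ\theta_j:\psi\in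 S(B_j)\},S(E))$. **Operational propinquity.** The pseudo-states of $\mathbb M=(M,\mathsf D,A,L,B,Q)$ are the functionals $\xi\mapsto\mu(\langle\omega,\xi\rangle)$ with $\mu\in S(B)$ and $\mathsf D(\omega)\le1$; their set is $\widetilde S(\mathbb M)$. For adjointable operators $a$ on the module of $\mathbb M_1$ and $b$ on that of $\mathbb M_2$, the operational propinquity $\Lambda^{\mathrm{op}}(a,b)$ is the infimum, over all tunnels $\tau$ from $\mathbb M_1$ to $\mathbb M_2$, of $$\max\Big\{\chi(\tau),\ \mathrm{Haus}_{\mathsf{mk}_{\mathsf T}}\big(\{\varphi\circ a\circ\Pi_1:\varphi\in\widetilde S(\mathbb M_1)\},\{\psi\circ b\circ\Pi_2:\psi\in\widetilde S(\mathbb M_2)\}\big)\Big\}.$$ **Metric spectral triples.** A metric spectral triple $(A,\mathcal H,\mathcal D)$ is a C*-algebra $A$ with a unital *-representation on a Hilbert space $\mathcal H$ and a self-adjoint operator $\mathcal D$ on $\mathcal H$ such that $\mathcal D+i$ has a compact inverse and, with $L_{\mathcal D}(a)=\|[\mathcal D,a]\|$ on $\{a\in\mathfrak{sa}(A):a\,\mathrm{dom}(\mathcal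 D)\subseteq\mathrm{dom}(\mathcal D),\ [\mathcal D,a]\text{ bounded}\}$, $(A,L_{\mathcal D})$ is a quantum compact metric space. With $\mathsf D_{\mathcal D}(\xi)=\|\xi\|+\|\mathcal D\xi\|$ on $\mathrm{dom}(\mathcal D)$, it defines the metrical C*-correspondence $(\mathcal H,\mathsf D_{\mathcal D},A,L_{\mathcal D},\mathbb C,0)$; tunnels between metric spectral triples are tunnels between these, and bounded operators on $\mathcal H$ are regarded as adjointable operators on its module $\mathcal H$. **Spectral propinquity.** For $\varepsilon>0$, an $\varepsilon$-iso-iso is a pair of maps $\varsigma_1,\varsigma_2:[0,\infty)\to[0,\infty)$ fixing $0$ with $\big||\varsigma_j(x)+\varsigma_j(y)-z|-|x+y-\varsigma_k(z)|\big|<\varepsilon$ for all $x,y,z\in[0,\frac1\varepsilon]$ and $\{j,k\}=\{1,2\}$. Given metric spectral triples $(A_j,\mathcal H_j,\mathcal D_j)$, $j=1,2$, put $U_j^t=\exp(it\mathcal D_j)$, and for a tunnel $\tau$ between them let the $\varepsilon$-magnitude of $(\tau,\varsigma_1,\varsigma_2)$ be the maximum of $\chi(\tau)$ and, for $(j,k)\in\{(1,2),(2,1)\}$,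 of $$\sup_{\mathsf D_{\mathcal D_j}(\xi)\le1}\ \inf_{\mathsf D_{\mathcal D_k}(\eta)\le1}\ \sup_{0\le t\le 1/\varepsilon}\ \sup_{\mathsf T(\omega)\le1}\big|\langle U_j^{-t}\xi,\Pi_j(\omega)\rangle-\langle U_k^{-\varsigma_j(t)}\eta,\Pi_k(\omega)\rangle\big|.$$ The spectral propinquity of the two triples is the infimum of $\frac{\sqrt2}{2}$ and of all $\varepsilon>0$ for which there are a tunnel $\tau$ and an $\varepsilon$-iso-iso $(\varsigma_1,\varsigma_2)$ such that the $\varepsilon$-magnitude of $(\tau,\varsigma_1,\varsigma_2)$ is $<\varepsilon$. **Theorem.** Let $(A_n,\mathcal H_n,\mathcal D_n)_{n\in\mathbb N}$ be a sequence of metric spectral triples which converges to a metric spectral triple $(A_\infty,\mathcal H_\infty,\mathcal D_\infty)$ for the spectral propinquity. Then, for every bounded continuous function $f:\mathbb R\to\mathbb C$, $$\lim_{n\to\infty}\Lambda^{\mathrm{op}}\big(f(\mathcal D_n),f(\mathcal D_\infty)\big)=0,$$ where $f(\mathcal D_n)$ and $f(\mathcal D_\infty)$ are given by the bounded continuous functional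 calculus of self-adjoint operators. -/

import Mathlib

open scoped ENNReal NNReal Topology BoundedContinuousFunction ComplexOrder ComplexStarModule

universe u v w

noncomputable section

/-! ### Generalities: Kantorovich and Hausdorff distances, with values in `[0, ∞]`

Seminorms and norms defined on a subspace only are extended by the value `∞` outside of their
domain, so they are functions with values in `ℝ≥0∞`, whose domain is the set of points where they
are finite. -/

/-- The Kantorovich distance `sup {|φ x - ψ x| : N x ≤ 1}` associated with the (semi)norm `N`. -/
def kantorovich {E : Type*} (N : E → ℝ≥0∞) (φ ψ : E → ℂ) : ℝ≥0∞ :=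
  ⨆ (x : E) (_ : N x ≤ 1), ‖φ x - ψ x‖ₑ

/-- The Kantorovich distance between two families of functionals with the same index set. -/
def kantorovichFamily {E : Type*} (N : E → ℝ≥0∞) {J : Type*} (φ ψ : J → E → ℂ) : ℝ≥0∞ :=
  ⨆ j : J, kantorovich N (φ j) (ψ j)

/-- `sup_{x ∈ A} inf_{y ∈ B} d x y`. -/
def directedHausdorff {X : Type*} (d : X → X → ℝ≥0∞) (A B : Set X) : ℝ≥0∞ :=
  ⨆ x ∈ A, ⨅ y ∈ B, d x y

/-- The Hausdorff distance between two sets, with respect to `d`. -/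
def hausdorff {X : Type*} (d : X → X → ℝ≥0∞) (A B : Set X) : ℝ≥0∞ :=
  max (directedHausdorff d A B) (directedHausdorff d B A)

/-! ### Quantum compact metric spaces -/

/-- The state space of a unital C*-algebra, in the dual endowed with its weak* topology. -/
def stateSpace (A : Type*) [CStarAlgebra A] : Set (WeakDual ℂ A) :=
  {φ | φ 1 = 1 ∧ ∀ a : A, 0 ≤ φ (star a * a)}

/-- `(A, L)` is an `(F, K)`-quantum compact metric space. The seminorm `L` is defined on the
subspace `{a | L a < ∞}` of the self-adjoint part of `A`. -/
structure IsQuantumCompactMetricSpace (F K : ℝ≥0) {A : Type*} [CStarAlgebra A]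
    (L : A → ℝ≥0∞) : Prop where
  isSelfAdjoint : ∀ a, L a < ⊤ → IsSelfAdjoint a
  smul : ∀ (t : ℝ) (a : A), L ((t : ℂ) • a) = ‖t‖ₑ * L a
  add_le : ∀ a b : A, L (a + b) ≤ L a + L b
  dense : ∀ a : A, IsSelfAdjoint a → a ∈ closure {b : A | L b < ⊤}
  one : L 1 = 0
  /-- The Kantorovich distance is a metric on the state space (symmetry and the triangle
  inequality being automatic). -/
  kantorovich_lt_top : ∀ φ ∈ stateSpace A, ∀ ψ ∈ stateSpace A, kantorovich L φ ψ < ⊤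
  eq_of_kantorovich_eq_zero : ∀ φ ∈ stateSpace A, ∀ ψ ∈ stateSpace A,
    kantorovich L φ ψ = 0 → φ = ψ
  /-- The Kantorovich distance induces the weak* topology on the state space. -/
  nhds_hasBasis : ∀ φ : stateSpace A, (𝓝 φ).HasBasis (fun ε : ℝ≥0∞ => 0 < ε)
    (fun ε => {ψ : stateSpace A | kantorovich L φ.1 ψ.1 < ε})
  leibniz_re : ∀ a b : A, L a < ⊤ → L b < ⊤ →
    L (ℜ (a * b) : A) ≤ F * (L a * ‖b‖ₑ + ‖a‖ₑ * L b) + K * L a * L b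
  leibniz_im : ∀ a b : A, L a < ⊤ → L b < ⊤ →
    L (ℑ (a * b) : A) ≤ F * (L a * ‖b‖ₑ + ‖a‖ₑ * L b) + K * L a * L b
  isClosed : IsClosed {a : A | L a ≤ 1}

/-! ### Metrical C*-correspondences -/

/-- A C*-correspondence: a right Hilbert C*-module `M` over `B`, with a unital *-morphism from `A`
to the adjointable operators of `M`. -/
structure CStarCorrespondence where
  M : Type u
  A : Type v
  B : Type w
  [instNormedAddCommGroup : NormedAddCommGroup M]
  [instNormedSpace : NormedSpace ℂ M]
  [instCompleteSpace : CompleteSpace M]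
  [instCStarAlgebraLeft : CStarAlgebra A]
  [instCStarAlgebraRight : CStarAlgebra B]
  /-- The right `B`-module structure; `ω · b` is written `MulOpposite.op b • ω`. -/
  [instModule : Module Bᵐᵒᵖ M]
  /-- The `B`-valued inner product. -/
  inner : M → M → B
  inner_add_right : ∀ ω η ζ, inner ω (η + ζ) = inner ω η + inner ω ζ
  inner_smul_right : ∀ (z : ℂ) (ω η), inner ω (z • η) = z • inner ω η
  inner_op_smul_right : ∀ (b : B) (ω η), inner ω (MulOpposite.op b • η) = inner ω η * b
  star_inner : ∀ ω η, star (inner η ω) = inner ω η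
  /-- `⟨ω, ω⟩` is a positive element of `B`. -/
  inner_self_nonneg : ∀ ω, ∃ b : B, inner ω ω = star b * b
  inner_self_eq_zero : ∀ ω, inner ω ω = 0 ↔ ω = 0
  norm_eq_sqrt : ∀ ω, ‖ω‖ = √‖inner ω ω‖
  /-- The left action of `A`, by adjointable operators. -/
  act : A →ₐ[ℂ] Module.End ℂ M
  inner_act_left : ∀ (a : A) (ω η), inner (act a ω) η = inner ω (act (star a) η)

attribute [instance] CStarCorrespondence.instNormedAddCommGroup
  CStarCorrespondence.instNormedSpace CStarCorrespondence.instCompleteSpace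
  CStarCorrespondence.instCStarAlgebraLeft CStarCorrespondence.instCStarAlgebraRight
  CStarCorrespondence.instModule

/-- The constants `F ≥ 1`, `K ≥ 0`, `G ≥ 1`, `H ≥ 2` of the various Leibniz inequalities, which are
fixed once and for all. -/
structure LeibnizConstants where
  F : ℝ≥0
  K : ℝ≥0
  G : ℝ≥0
  H : ℝ≥0
  one_le_F : 1 ≤ F
  one_le_G : 1 ≤ G
  two_le_H : 2 ≤ H

/-- An `(F, K, G, H)`-metrical C*-correspondence. The D-norm `dnorm` is defined on the subspace
`{ω | dnorm ω < ∞}`. -/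
structure MetricalCorrespondence (Λ : LeibnizConstants) extends CStarCorrespondence.{u, v, w} where
  /-- The seminorm on the algebra `A` acting on the left. -/
  lip : A → ℝ≥0∞
  /-- The seminorm on the algebra `B` acting on the right. -/
  slip : B → ℝ≥0∞
  dnorm : M → ℝ≥0∞
  lip_isQCMS : IsQuantumCompactMetricSpace Λ.F Λ.K lip
  slip_isQCMS : IsQuantumCompactMetricSpace Λ.F Λ.K slip
  dnorm_smul : ∀ (z : ℂ) (ω : M), dnorm (z • ω) = ‖z‖ₑ * dnorm ω
  dnorm_add_le : ∀ ω η : M, dnorm (ω + η) ≤ dnorm ω + dnorm η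
  dnorm_dense : Dense {ω : M | dnorm ω < ⊤}
  norm_le_dnorm : ∀ ω : M, ‖ω‖ₑ ≤ dnorm ω
  isCompact : IsCompact {ω : M | dnorm ω ≤ 1}
  modular_leibniz : ∀ (a : A) (ω : M), lip a < ⊤ → dnorm ω < ⊤ →
    dnorm (act a ω) ≤ Λ.G * (‖a‖ₑ + lip a) * dnorm ω
  inner_leibniz_re : ∀ ω η : M, dnorm ω < ⊤ → dnorm η < ⊤ →
    slip (ℜ (inner ω η) : B) ≤ Λ.H * dnorm ω * dnorm η
  inner_leibniz_im : ∀ ω η : M, dnorm ω < ⊤ → dnorm η < ⊤ →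
    slip (ℑ (inner ω η) : B) ≤ Λ.H * dnorm ω * dnorm η

/-- A modular quantum isometry: a Lipschitz morphism `(Π, π, θ)` of metrical C*-correspondences
such that the (semi)norms of the codomain are the quotients of those of the domain. -/
structure ModularQuantumIsometry {Λ : LeibnizConstants}
    (M₁ M₂ : MetricalCorrespondence.{u, v, w} Λ) where
  /-- The map `Π` between the modules. -/
  mapM : M₁.M →L[ℂ] M₂.M
  /-- The map `π` between the algebras acting on the left. -/
  mapA : M₁.A →⋆ₐ[ℂ] M₂.A
  /-- The map `θ` between the algebras acting on the right. -/
  mapB : M₁.B →⋆ₐ[ℂ] M₂.B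
  map_act : ∀ (a : M₁.A) (ω : M₁.M), mapM (M₁.act a ω) = M₂.act (mapA a) (mapM ω)
  map_op_smul : ∀ (b : M₁.B) (ω : M₁.M),
    mapM (MulOpposite.op b • ω) = MulOpposite.op (mapB b) • mapM ω
  map_inner : ∀ ω η : M₁.M, mapB (M₁.inner ω η) = M₂.inner (mapM ω) (mapM η)
  lip_lt_top : ∀ a : M₁.A, M₁.lip a < ⊤ → M₂.lip (mapA a) < ⊤
  slip_lt_top : ∀ b : M₁.B, M₁.slip b < ⊤ → M₂.slip (mapB b) < ⊤
  dnorm_lt_top : ∀ ω : M₁.M, M₁.dnorm ω < ⊤ → M₂.dnorm (mapM ω) < ⊤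
  lip_eq : ∀ a : M₂.A, M₂.lip a < ⊤ → M₂.lip a = ⨅ (d : M₁.A) (_ : mapA d = a), M₁.lip d
  slip_eq : ∀ b : M₂.B, M₂.slip b < ⊤ → M₂.slip b = ⨅ (d : M₁.B) (_ : mapB d = b), M₁.slip d
  dnorm_eq : ∀ ω : M₂.M, M₂.dnorm ω < ⊤ →
    M₂.dnorm ω = ⨅ (η : M₁.M) (_ : mapM η = ω), M₁.dnorm η

/-- A metrical tunnel from `M₁` to `M₂`. The algebras and the module of a metrical
C*-correspondence are separable, hence have at most the cardinality of the continuum, so that the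
universe levels put no restriction on tunnels. -/
structure Tunnel {Λ : LeibnizConstants} (M₁ M₂ : MetricalCorrespondence.{u, v, w} Λ) where
  P : MetricalCorrespondence.{u, v, w} Λ
  left : ModularQuantumIsometry P M₁
  right : ModularQuantumIsometry P M₂

namespace Tunnel

variable {Λ : LeibnizConstants} {M₁ M₂ : MetricalCorrespondence.{u, v, w} Λ}

/-- The reversed tunnel. -/
def symm (τ : Tunnel M₁ M₂) : Tunnel M₂ M₁ := ⟨τ.P, τ.right, τ.left⟩

/-- The distance from `{φ ∘ π : φ ∈ S(A)}` to the state space of `D`. -/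
def stateDist {D A : Type*} [CStarAlgebra D] [CStarAlgebra A] (L : D → ℝ≥0∞)
    (π : D →⋆ₐ[ℂ] A) : ℝ≥0∞ :=
  hausdorff (kantorovich L) {g : D → ℂ | ∃ φ ∈ stateSpace A, g = fun d => φ (π d)}
    {g : D → ℂ | ∃ φ ∈ stateSpace D, g = φ}

/-- The extent of a tunnel. -/
def extent (τ : Tunnel M₁ M₂) : ℝ≥0∞ :=
  max (max (stateDist τ.P.lip τ.left.mapA) (stateDist τ.P.slip τ.left.mapB))
    (max (stateDist τ.P.lip τ.right.mapA) (stateDist τ.P.slip τ.right.mapB))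

end Tunnel

/-! ### The operational propinquity -/

/-- The adjointable `B`-linear continuous operators on the module of a C*-correspondence. -/
structure CStarCorrespondence.AdjointableOperator (X : CStarCorrespondence.{u, v, w}) where
  op : X.M →L[ℂ] X.M
  map_op_smul : ∀ (b : X.B) (ω : X.M), op (MulOpposite.op b • ω) = MulOpposite.op b • op ω
  adjointable : ∃ S : X.M →L[ℂ] X.M, ∀ ω η, X.inner (op ω) η = X.inner ω (S η)

section Operational

variable {Λ : LeibnizConstants}

/-- The pseudo-states `ξ ↦ μ ⟨ω, ξ⟩`, with `μ` a state of `B` and `ω` in the unit ball of the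
D-norm. -/
def MetricalCorrespondence.pseudoStates (X : MetricalCorrespondence.{u, v, w} Λ) :
    Set (X.M → ℂ) :=
  {φ | ∃ μ ∈ stateSpace X.B, ∃ ω : X.M, X.dnorm ω ≤ 1 ∧ φ = fun ξ => μ (X.inner ω ξ)}

variable {X Y : MetricalCorrespondence.{u, v, w} Λ} {J : Type*}

/-- The separation, according to the tunnel `τ`, of two families of operators. -/
def Tunnel.separation (τ : Tunnel X Y) (a : J → X.AdjointableOperator)
    (b : J → Y.AdjointableOperator) : ℝ≥0∞ :=
  hausdorff (kantorovichFamily τ.P.dnorm)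
    {g : J → τ.P.M → ℂ | ∃ φ ∈ X.pseudoStates, g = fun j ω => φ ((a j).op (τ.left.mapM ω))}
    {g : J → τ.P.M → ℂ | ∃ ψ ∈ Y.pseudoStates, g = fun j ω => ψ ((b j).op (τ.right.mapM ω))}

/-- The dispersion, according to the tunnel `τ`, of two families of operators. -/
def Tunnel.dispersion (τ : Tunnel X Y) (a : J → X.AdjointableOperator)
    (b : J → Y.AdjointableOperator) : ℝ≥0∞ :=
  max τ.extent (τ.separation a b)

/-- The operational propinquity between two families of operators. -/
def operationalPropinquity (a : J → X.AdjointableOperator) (b : J → Y.AdjointableOperator) :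
    ℝ≥0∞ :=
  ⨅ τ : Tunnel X Y, τ.dispersion a b

end Operational

/-! ### Metric spectral triples -/

section Dirac

variable {A : Type*} [CStarAlgebra A] {H : Type*} [NormedAddCommGroup H] [InnerProductSpace ℂ H]
  [CompleteSpace H]

open Classical in
/-- The seminorm `a ↦ ‖[D, a]‖`, defined on the self-adjoint elements `a` which preserve the domain
of `D` and for which `[D, a]` is bounded, and equal to `∞` elsewhere. -/
def commutatorSeminorm (ρ : A →⋆ₐ[ℂ] (H →L[ℂ] H)) (D : H →ₗ.[ℂ] H) (a : A) : ℝ≥0∞ :=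
  if h : IsSelfAdjoint a ∧ ∀ ξ : D.domain, ρ a ξ ∈ D.domain then
    ⨆ (ξ : D.domain) (_ : ‖(ξ : H)‖ ≤ 1), ‖D ⟨ρ a ξ, h.2 ξ⟩ - ρ a (D ξ)‖ₑ
  else ⊤

open Classical in
/-- The graph norm `‖ξ‖ + ‖D ξ‖`, equal to `∞` outside of the domain of `D`. -/
def graphNorm (D : H →ₗ.[ℂ] H) (ξ : H) : ℝ≥0∞ :=
  if h : ξ ∈ D.domain then ‖ξ‖ₑ + ‖D ⟨ξ, h⟩‖ₑ else ⊤

end Dirac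

/-- A metric spectral triple `(A, H, D)`. -/
structure MetricSpectralTriple (Λ : LeibnizConstants) where
  A : Type v
  H : Type u
  [instCStarAlgebra : CStarAlgebra A]
  [instNormedAddCommGroup : NormedAddCommGroup H]
  [instInnerProductSpace : InnerProductSpace ℂ H]
  [instCompleteSpace : CompleteSpace H]
  /-- The unital *-representation of `A` on `H`. -/
  rep : A →⋆ₐ[ℂ] (H →L[ℂ] H)
  /-- The Dirac operator. -/
  D : H →ₗ.[ℂ] H
  isSelfAdjoint : IsSelfAdjoint D
  /-- `D + i` has a compact inverse. -/
  compact_inverse : ∃ R : H →L[ℂ] H, IsCompactOperator R ∧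
    (∀ ξ : D.domain, R (D ξ + Complex.I • (ξ : H)) = ξ) ∧
    ∀ η : H, ∃ ξ : D.domain, R η = ξ ∧ D ξ + Complex.I • (ξ : H) = η
  dense : ∀ a : A, IsSelfAdjoint a → a ∈ closure {b : A | commutatorSeminorm rep D b < ⊤}
  metric : IsQuantumCompactMetricSpace Λ.F Λ.K (commutatorSeminorm rep D)

attribute [instance] MetricSpectralTriple.instCStarAlgebra
  MetricSpectralTriple.instNormedAddCommGroup MetricSpectralTriple.instInnerProductSpace
  MetricSpectralTriple.instCompleteSpace

/-! ### The quantum compact metric space `(ℂ, 0)` -/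

open Classical in
/-- The zero seminorm on the self-adjoint part `ℝ` of `ℂ`. -/
def trivialSeminorm (z : ℂ) : ℝ≥0∞ := if IsSelfAdjoint z then 0 else ⊤

theorem trivialSeminorm_of_isSelfAdjoint {z : ℂ} (h : IsSelfAdjoint z) : trivialSeminorm z = 0 :=
  if_pos h

theorem isSelfAdjoint_of_trivialSeminorm {z : ℂ} (h : trivialSeminorm z < ⊤) :
    IsSelfAdjoint z := by
  by_contra hc
  rw [trivialSeminorm, if_neg hc] at h
  exact lt_irrefl _ h

theorem state_complex_eq {φ ψ : WeakDual ℂ ℂ} (hφ : φ ∈ stateSpace ℂ) (hψ : ψ ∈ stateSpace ℂ) :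
    φ = ψ := by
  have h : ∀ χ ∈ stateSpace ℂ, ∀ z : ℂ, χ z = z := fun χ hχ z => by
    have h1 : χ (z • 1) = z • χ 1 := map_smul χ z 1
    rw [hχ.1] at h1
    simpa using h1
  exact DFunLike.ext _ _ fun z => (h φ hφ z).trans (h ψ hψ z).symm

theorem trivialSeminorm_isQCMS (F K : ℝ≥0) :
    IsQuantumCompactMetricSpace F K trivialSeminorm where
  isSelfAdjoint _ := isSelfAdjoint_of_trivialSeminorm
  smul t z := by
    by_cases hz : IsSelfAdjoint z
    · have h2 : IsSelfAdjoint ((t : ℂ) • z) := by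
        rw [smul_eq_mul]
        exact IsSelfAdjoint.mul (Complex.conj_ofReal t) hz
      rw [trivialSeminorm_of_isSelfAdjoint hz, trivialSeminorm_of_isSelfAdjoint h2, mul_zero]
    · by_cases ht : t = 0
      · subst ht
        rw [trivialSeminorm_of_isSelfAdjoint (by simp)]
        simp
      · rw [trivialSeminorm, trivialSeminorm, if_neg hz, ENNReal.mul_top (by simpa using ht)]
        exact le_top.antisymm (by
          by_cases h2 : IsSelfAdjoint ((t : ℂ) • z)
          · refine absurd ?_ hz
            have h3 : IsSelfAdjoint (((t⁻¹ : ℝ) : ℂ) * ((t : ℂ) * z)) :=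
              IsSelfAdjoint.mul (Complex.conj_ofReal _) h2
            rwa [← mul_assoc, ← Complex.ofReal_mul, inv_mul_cancel₀ ht, Complex.ofReal_one,
              one_mul] at h3
          · rw [if_neg h2])
  add_le a b := by
    by_cases ha : IsSelfAdjoint a
    · by_cases hb : IsSelfAdjoint b
      · rw [trivialSeminorm_of_isSelfAdjoint (ha.add hb)]
        exact zero_le
      · rw [trivialSeminorm, trivialSeminorm, trivialSeminorm, if_neg hb, add_top]
        exact le_top
    · rw [trivialSeminorm, trivialSeminorm, trivialSeminorm, if_neg ha, top_add]
      exact le_top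
  dense a ha := subset_closure (by
    change trivialSeminorm a < ⊤
    rw [trivialSeminorm_of_isSelfAdjoint ha]
    exact ENNReal.zero_lt_top)
  one := trivialSeminorm_of_isSelfAdjoint (IsSelfAdjoint.one ℂ)
  kantorovich_lt_top φ hφ ψ hψ := by
    rw [state_complex_eq hφ hψ]
    simp [kantorovich]
  eq_of_kantorovich_eq_zero φ hφ ψ hψ _ := state_complex_eq hφ hψ
  nhds_hasBasis φ := by
    have : Subsingleton (stateSpace ℂ) :=
      ⟨fun a b => Subtype.ext (state_complex_eq a.2 b.2)⟩
    have h : ∀ ε : ℝ≥0∞, 0 < ε →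
        {ψ : stateSpace ℂ | kantorovich trivialSeminorm φ.1 ψ.1 < ε} = Set.univ := fun ε hε => by
      refine Set.eq_univ_of_forall fun ψ => ?_
      change kantorovich trivialSeminorm φ.1 ψ.1 < ε
      rw [Subsingleton.elim ψ φ]
      simpa [kantorovich] using hε
    refine ⟨fun s => ⟨fun hs => ⟨1, one_pos, ?_⟩, ?_⟩⟩
    · intro ψ _
      rw [Subsingleton.elim ψ φ]
      exact mem_of_mem_nhds hs
    · rintro ⟨ε, hε, hs⟩
      rw [h ε hε] at hs
      exact Filter.mem_of_superset Filter.univ_mem hs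
  leibniz_re a b _ _ := by
    rw [trivialSeminorm_of_isSelfAdjoint (ℜ (a * b)).2]
    exact zero_le
  leibniz_im a b _ _ := by
    rw [trivialSeminorm_of_isSelfAdjoint (ℑ (a * b)).2]
    exact zero_le
  isClosed := by
    have h : {a : ℂ | trivialSeminorm a ≤ 1} = {a : ℂ | star a = a} := by
      ext a
      constructor
      · intro ha
        exact isSelfAdjoint_of_trivialSeminorm (lt_of_le_of_lt ha ENNReal.one_lt_top)
      · intro ha
        change trivialSeminorm a ≤ 1
        rw [trivialSeminorm_of_isSelfAdjoint ha]
        exact zero_le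
    rw [h]
    exact isClosed_eq continuous_star continuous_id

namespace MetricSpectralTriple

variable {Λ : LeibnizConstants} (T : MetricSpectralTriple.{u, v} Λ)

/-! #### The bounded continuous functional calculus of the Dirac operator -/

/-- The eigenspace `{ξ ∈ dom D : D ξ = x ξ}` of the Dirac operator. -/
def eigenspace (x : ℝ) : Submodule ℂ T.H :=
  T.D.graph.comap (LinearMap.prod LinearMap.id ((x : ℂ) • LinearMap.id))

theorem mem_eigenspace {x : ℝ} {ξ : T.H} :
    ξ ∈ T.eigenspace x ↔ ∃ h : ξ ∈ T.D.domain, T.D ⟨ξ, h⟩ = (x : ℂ) • ξ := by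
  change (ξ, (x : ℂ) • ξ) ∈ T.D.graph ↔ _
  simp only [LinearPMap.mem_graph_iff]
  constructor
  · rintro ⟨y, rfl, hy⟩
    exact ⟨y.2, hy⟩
  · rintro ⟨h, hy⟩
    exact ⟨⟨ξ, h⟩, rfl, hy⟩

theorem inner_D (ξ η : T.D.domain) : inner ℂ (T.D ξ) (η : T.H) = inner ℂ (ξ : T.H) (T.D η) := by
  have h := LinearPMap.adjoint_isFormalAdjoint (T := T.D) T.isSelfAdjoint.dense_domain
  have h2 := (LinearPMap.isSelfAdjoint_def).1 T.isSelfAdjoint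
  rw [h2] at h
  exact h ξ η

theorem isClosed_eigenspace (x : ℝ) : IsClosed (T.eigenspace x : Set T.H) := by
  have h : IsClosed (T.D.graph : Set (T.H × T.H)) := T.isSelfAdjoint.isClosed
  exact h.preimage (f := fun ξ : T.H => (ξ, (x : ℂ) • ξ)) (by fun_prop)

instance (x : ℝ) : CompleteSpace (T.eigenspace x) :=
  (T.isClosed_eigenspace x).completeSpace_coe

theorem orthogonalFamily :
    OrthogonalFamily ℂ (fun x : ℝ => T.eigenspace x) (fun x => (T.eigenspace x).subtypeₗᵢ) := by
  intro x y hxy ξ η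
  obtain ⟨hξ, hξ'⟩ := T.mem_eigenspace.1 ξ.2
  obtain ⟨hη, hη'⟩ := T.mem_eigenspace.1 η.2
  have h := T.inner_D ⟨ξ, hξ⟩ ⟨η, hη⟩
  rw [hξ', hη'] at h
  simp only [inner_smul_left, inner_smul_right, Complex.conj_ofReal] at h
  have h3 : ((x : ℂ) - y) * inner ℂ (ξ : T.H) (η : T.H) = 0 := by
    rw [sub_mul, sub_eq_zero]; exact h
  rcases mul_eq_zero.1 h3 with h4 | h4
  · exact absurd (by exact_mod_cast sub_eq_zero.1 h4) hxy
  · exact h4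

/-- The orthogonal projection on the eigenspace for `x`. -/
def eigenproj (x : ℝ) : T.H →L[ℂ] T.H := (T.eigenspace x).starProjection

theorem norm_sq_sum_eigenproj (c : ℝ → ℂ) (s : Finset ℝ) (ξ : T.H) :
    ‖∑ x ∈ s, c x • T.eigenproj x ξ‖ ^ 2 = ∑ x ∈ s, ‖c x • T.eigenproj x ξ‖ ^ 2 := by
  exact T.orthogonalFamily.norm_sum
    (fun x => c x • ⟨T.eigenproj x ξ, Submodule.starProjection_apply_mem _ _⟩) s

theorem sum_norm_sq_eigenproj_le (s : Finset ℝ) (ξ : T.H) :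
    ∑ x ∈ s, ‖T.eigenproj x ξ‖ ^ 2 ≤ ‖ξ‖ ^ 2 := by
  set y := ∑ x ∈ s, T.eigenproj x ξ with hy
  have h1 : ‖y‖ ^ 2 = ∑ x ∈ s, ‖T.eigenproj x ξ‖ ^ 2 := by
    simpa using T.norm_sq_sum_eigenproj (fun _ => 1) s ξ
  have h2 : ∑ x ∈ s, ‖T.eigenproj x ξ‖ ^ 2 = RCLike.re (inner ℂ y ξ) := by
    rw [hy, sum_inner, map_sum]
    refine Finset.sum_congr rfl fun x _ => ?_
    exact (Submodule.re_inner_starProjection_eq_normSq (T.eigenspace x) ξ).symm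
  have h3 : ‖y‖ ^ 2 ≤ ‖y‖ * ‖ξ‖ := by
    rw [h1, h2]; exact re_inner_le_norm y ξ
  rw [← h1]
  have h4 : ‖y‖ ≤ ‖ξ‖ := by
    by_contra hlt
    push Not at hlt
    nlinarith [norm_nonneg y, norm_nonneg ξ]
  gcongr

theorem norm_sum_eigenproj_le (f : ℝ →ᵇ ℂ) (s : Finset ℝ) (ξ : T.H) :
    ‖∑ x ∈ s, f x • T.eigenproj x ξ‖ ≤ ‖f‖ * ‖ξ‖ := by
  refine le_of_sq_le_sq ?_ (by positivity)
  rw [T.norm_sq_sum_eigenproj, mul_pow]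
  calc ∑ x ∈ s, ‖f x • T.eigenproj x ξ‖ ^ 2
      ≤ ∑ x ∈ s, ‖f‖ ^ 2 * ‖T.eigenproj x ξ‖ ^ 2 := by
        refine Finset.sum_le_sum fun x _ => ?_
        rw [norm_smul, mul_pow]
        gcongr
        exact f.norm_coe_le_norm x
    _ = ‖f‖ ^ 2 * ∑ x ∈ s, ‖T.eigenproj x ξ‖ ^ 2 := by rw [Finset.mul_sum]
    _ ≤ ‖f‖ ^ 2 * ‖ξ‖ ^ 2 := by
        gcongr
        exact T.sum_norm_sq_eigenproj_le s ξ

theorem summable_eigenproj (f : ℝ →ᵇ ℂ) (ξ : T.H) :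
    Summable fun x : ℝ => f x • T.eigenproj x ξ := by
  let g : ∀ x : ℝ, T.eigenspace x := fun x =>
    f x • ⟨T.eigenproj x ξ, Submodule.starProjection_apply_mem _ _⟩
  have hg : ∀ x, (T.eigenspace x).subtypeₗᵢ (g x) = f x • T.eigenproj x ξ := fun _ => rfl
  have h1 : Summable fun x => ‖g x‖ ^ 2 := by
    refine summable_of_sum_le (c := (‖f‖ * ‖ξ‖) ^ 2) (fun _ => by positivity) fun s => ?_
    have h2 : ∀ x, ‖g x‖ = ‖f x • T.eigenproj x ξ‖ := fun _ => rfl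
    simp only [h2]
    rw [← T.norm_sq_sum_eigenproj f s ξ]
    gcongr
    exact T.norm_sum_eigenproj_le f s ξ
  have h3 := (T.orthogonalFamily.summable_iff_norm_sq_summable g).2 h1
  simpa only [hg] using h3

/-- The operator `f(D) = ∑ₓ f(x) Pₓ`, for `f` bounded and continuous on `ℝ`, where `Pₓ` is the
orthogonal projection on the eigenspace of `D` for `x` (nonzero only for `x` in the spectrum of `D`,
which is discrete since `D` has compact resolvent), the sum being convergent for the strong operator
topology. -/
def funcCalc (f : ℝ →ᵇ ℂ) : T.H →L[ℂ] T.H :=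
  LinearMap.mkContinuous
    { toFun := fun ξ => ∑' x : ℝ, f x • T.eigenproj x ξ
      map_add' := fun ξ η => by
        rw [← (T.summable_eigenproj f ξ).tsum_add (T.summable_eigenproj f η)]
        simp only [map_add, smul_add]
      map_smul' := fun z ξ => by
        rw [RingHom.id_apply, ← (T.summable_eigenproj f ξ).tsum_const_smul z]
        simp only [map_smul]
        exact tsum_congr fun x => smul_comm _ _ _ }
    ‖f‖ fun ξ => by
      refine le_of_tendsto (T.summable_eigenproj f ξ).hasSum.norm (Filter.Eventually.of_forall ?_)
      exact fun s => T.norm_sum_eigenproj_le f s ξ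

theorem norm_exp_I_mul (t x : ℝ) : ‖Complex.exp (Complex.I * t * x)‖ = 1 := by
  have h : Complex.I * t * x = ((t * x : ℝ) : ℂ) * Complex.I := by push_cast; ring
  exact (congrArg (fun z => ‖Complex.exp z‖) h).trans (Complex.norm_exp_ofReal_mul_I (t * x))

/-- The function `x ↦ exp(i t x)`. -/
def expFun (t : ℝ) : ℝ →ᵇ ℂ :=
  BoundedContinuousFunction.ofNormedAddCommGroup (fun x : ℝ => Complex.exp (Complex.I * t * x))
    (by fun_prop) 1 (fun x => (norm_exp_I_mul t x).le)

/-- The unitary `U^t = exp(i t D)`. -/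
def U (t : ℝ) : T.H →L[ℂ] T.H := T.funcCalc (expFun t)

/-! #### The metrical C*-correspondence of a metric spectral triple -/

theorem graphNorm_of_mem {ξ : T.H} (h : ξ ∈ T.D.domain) :
    graphNorm T.D ξ = ‖ξ‖ₑ + ‖T.D ⟨ξ, h⟩‖ₑ := dif_pos h

theorem mem_domain_of_graphNorm {ξ : T.H} (h : graphNorm T.D ξ < ⊤) : ξ ∈ T.D.domain := by
  by_contra hc
  rw [graphNorm, dif_neg hc] at h
  exact lt_irrefl _ h

theorem graphNorm_lt_top {ξ : T.H} (h : ξ ∈ T.D.domain) : graphNorm T.D ξ < ⊤ := by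
  rw [T.graphNorm_of_mem h]
  exact ENNReal.add_lt_top.2 ⟨enorm_lt_top, enorm_lt_top⟩

theorem graphNorm_smul (z : ℂ) (ξ : T.H) :
    graphNorm T.D (z • ξ) = ‖z‖ₑ * graphNorm T.D ξ := by
  by_cases h : ξ ∈ T.D.domain
  · have h2 : z • ξ ∈ T.D.domain := T.D.domain.smul_mem z h
    have h3 : T.D ⟨z • ξ, h2⟩ = z • T.D ⟨ξ, h⟩ := T.D.map_smul z ⟨ξ, h⟩
    rw [T.graphNorm_of_mem h, T.graphNorm_of_mem h2, h3, enorm_smul, enorm_smul, mul_add]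
  · by_cases hz : z = 0
    · subst hz
      have h2 : (0 : ℂ) • ξ ∈ T.D.domain := by rw [zero_smul]; exact T.D.domain.zero_mem
      have h3 : T.D ⟨(0 : ℂ) • ξ, h2⟩ = 0 := by
        have : (⟨(0 : ℂ) • ξ, h2⟩ : T.D.domain) = 0 := Subtype.ext (zero_smul _ _)
        rw [this, LinearPMap.map_zero]
      rw [T.graphNorm_of_mem h2, h3]
      simp
    · have h2 : z • ξ ∉ T.D.domain := fun hc => h (by
        have := T.D.domain.smul_mem z⁻¹ hc
        rwa [smul_smul, inv_mul_cancel₀ hz, one_smul] at this)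
      rw [graphNorm, dif_neg h2, graphNorm, dif_neg h, ENNReal.mul_top]
      simpa using hz

theorem graphNorm_add_le (ξ η : T.H) :
    graphNorm T.D (ξ + η) ≤ graphNorm T.D ξ + graphNorm T.D η := by
  by_cases h : ξ ∈ T.D.domain
  · by_cases h' : η ∈ T.D.domain
    · have h2 : ξ + η ∈ T.D.domain := T.D.domain.add_mem h h'
      have h3 : T.D ⟨ξ + η, h2⟩ = T.D ⟨ξ, h⟩ + T.D ⟨η, h'⟩ := T.D.map_add ⟨ξ, h⟩ ⟨η, h'⟩
      rw [T.graphNorm_of_mem h, T.graphNorm_of_mem h', T.graphNorm_of_mem h2, h3,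
        add_add_add_comm]
      exact add_le_add (enorm_add_le _ _) (enorm_add_le _ _)
    · rw [graphNorm, graphNorm, graphNorm, dif_neg h', add_top]
      exact le_top
  · rw [graphNorm, graphNorm, graphNorm, dif_neg h, top_add]
    exact le_top

theorem enorm_le_graphNorm (ξ : T.H) : ‖ξ‖ₑ ≤ graphNorm T.D ξ := by
  by_cases h : ξ ∈ T.D.domain
  · rw [T.graphNorm_of_mem h]
    exact le_self_add
  · rw [graphNorm, dif_neg h]
    exact le_top

theorem dense_graphNorm : Dense {ξ : T.H | graphNorm T.D ξ < ⊤} :=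
  T.isSelfAdjoint.dense_domain.mono fun _ h => T.graphNorm_lt_top h

theorem graphNorm_le_one_iff {ξ : T.H} (h : ξ ∈ T.D.domain) :
    graphNorm T.D ξ ≤ 1 ↔ ‖ξ‖ + ‖T.D ⟨ξ, h⟩‖ ≤ 1 := by
  rw [T.graphNorm_of_mem h, enorm_eq_nnnorm, enorm_eq_nnnorm]
  norm_cast

theorem isCompact_graphNorm : IsCompact {ξ : T.H | graphNorm T.D ξ ≤ 1} := by
  obtain ⟨R, hR, hR1, hR2⟩ := T.compact_inverse
  have hval : ∀ (ξ : T.H) (h : ξ ∈ T.D.domain),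
      R (T.D ⟨ξ, h⟩ + Complex.I • ξ) = ξ := fun ξ h => hR1 ⟨ξ, h⟩
  have hsub : {ξ : T.H | graphNorm T.D ξ ≤ 1} ⊆ R '' Metric.closedBall 0 1 := by
    intro ξ hξ
    have hd : ξ ∈ T.D.domain := T.mem_domain_of_graphNorm (lt_of_le_of_lt hξ ENNReal.one_lt_top)
    refine ⟨T.D ⟨ξ, hd⟩ + Complex.I • ξ, ?_, hval ξ hd⟩
    rw [mem_closedBall_zero_iff]
    refine (norm_add_le _ _).trans ?_
    rw [norm_smul, Complex.norm_I, one_mul, add_comm]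
    exact (T.graphNorm_le_one_iff hd).1 hξ
  have hcl : IsClosed {ξ : T.H | graphNorm T.D ξ ≤ 1} := by
    refine isClosed_of_closure_subset fun ξ hξ => ?_
    obtain ⟨u, hu, hlim⟩ := mem_closure_iff_seq_limit.1 hξ
    have hd : ∀ n, u n ∈ T.D.domain := fun n =>
      T.mem_domain_of_graphNorm (lt_of_le_of_lt (hu n) ENNReal.one_lt_top)
    have hu' : ∀ n, ‖u n‖ + ‖T.D ⟨u n, hd n⟩‖ ≤ 1 := fun n => (T.graphNorm_le_one_iff (hd n)).1 (hu n)
    have key : ∀ η : T.D.domain, ‖inner ℂ ξ (T.D η)‖ ≤ (1 - ‖ξ‖) * ‖(η : T.H)‖ := fun η => by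
      have h1 : Filter.Tendsto (fun n => ‖inner ℂ (u n) (T.D η)‖) Filter.atTop
          (𝓝 ‖inner ℂ ξ (T.D η)‖) := (hlim.inner tendsto_const_nhds).norm
      have h2 : Filter.Tendsto (fun n => (1 - ‖u n‖) * ‖(η : T.H)‖) Filter.atTop
          (𝓝 ((1 - ‖ξ‖) * ‖(η : T.H)‖)) := (tendsto_const_nhds.sub hlim.norm).mul_const _
      refine le_of_tendsto_of_tendsto' h1 h2 fun n => ?_
      rw [← T.inner_D ⟨u n, hd n⟩ η]
      refine (norm_inner_le_norm _ _).trans ?_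
      gcongr
      linarith [hu' n]
    have hmem : ξ ∈ T.D.domain := by
      have h2 := (LinearPMap.isSelfAdjoint_def).1 T.isSelfAdjoint
      rw [← h2, LinearPMap.mem_adjoint_domain_iff]
      exact AddMonoidHomClass.continuous_of_bound ((innerₛₗ ℂ ξ).comp T.D.toFun) (1 - ‖ξ‖) key
    refine (T.graphNorm_le_one_iff hmem).2 ?_
    have h3 : ∀ η : T.H, ‖inner ℂ (T.D ⟨ξ, hmem⟩) η‖ ≤ (1 - ‖ξ‖) * ‖η‖ := fun η => by
      refine T.isSelfAdjoint.dense_domain.induction (P := fun η =>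
        ‖inner ℂ (T.D ⟨ξ, hmem⟩) η‖ ≤ (1 - ‖ξ‖) * ‖η‖) (fun η hη => ?_) ?_ η
      · rw [T.inner_D ⟨ξ, hmem⟩ ⟨η, hη⟩]
        exact key ⟨η, hη⟩
      · exact isClosed_le (by fun_prop) (by fun_prop)
    have h5 : 0 ≤ 1 - ‖ξ‖ := by
      have := le_of_tendsto' hlim.norm (fun n =>
        (le_add_of_nonneg_right (norm_nonneg _)).trans (hu' n))
      linarith
    have h4 := h3 (T.D ⟨ξ, hmem⟩)
    rw [inner_self_eq_norm_sq_to_K, norm_pow, RCLike.norm_ofReal, abs_norm] at h4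
    by_contra hc
    push Not at hc
    nlinarith [norm_nonneg (T.D ⟨ξ, hmem⟩), norm_nonneg ξ]
  exact ((hR.isCompact_closure_image_closedBall 1)).of_isClosed_subset hcl
    (hsub.trans subset_closure)

theorem norm_rep_le (a : T.A) (ξ : T.H) : ‖T.rep a ξ‖ ≤ ‖a‖ * ‖ξ‖ :=
  ((T.rep a).le_opNorm ξ).trans (by gcongr; exact NonUnitalStarAlgHom.norm_apply_le T.rep a)

theorem graphNorm_rep_le (a : T.A) (ξ : T.H) (ha : commutatorSeminorm T.rep T.D a < ⊤)
    (hξ : graphNorm T.D ξ < ⊤) : graphNorm T.D (T.rep a ξ) ≤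
      Λ.G * (‖a‖ₑ + commutatorSeminorm T.rep T.D a) * graphNorm T.D ξ := by
  have hd := T.mem_domain_of_graphNorm hξ
  have hrep : ∀ η : T.H, ‖T.rep a η‖ₑ ≤ ‖a‖ₑ * ‖η‖ₑ := fun η => by
    have h := T.norm_rep_le a η
    rw [enorm_eq_nnnorm, enorm_eq_nnnorm, enorm_eq_nnnorm]
    exact_mod_cast h
  have h : IsSelfAdjoint a ∧ ∀ ξ : T.D.domain, T.rep a ξ ∈ T.D.domain := by
    by_contra hc
    rw [commutatorSeminorm, dif_neg hc] at ha
    exact lt_irrefl _ ha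
  have hL : commutatorSeminorm T.rep T.D a = ⨆ (ξ : T.D.domain) (_ : ‖(ξ : T.H)‖ ≤ 1),
      ‖T.D ⟨T.rep a ξ, h.2 ξ⟩ - T.rep a (T.D ξ)‖ₑ := dif_pos h
  -- the commutator is bounded by its norm
  have hcomm : ‖T.D ⟨T.rep a ξ, h.2 ⟨ξ, hd⟩⟩ - T.rep a (T.D ⟨ξ, hd⟩)‖ₑ ≤
      commutatorSeminorm T.rep T.D a * ‖ξ‖ₑ := by
    by_cases h0 : ξ = 0
    · subst h0
      have e1 : (⟨0, hd⟩ : T.D.domain) = 0 := rfl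
      have e2 : (⟨T.rep a 0, h.2 ⟨0, hd⟩⟩ : T.D.domain) = 0 := Subtype.ext (map_zero _)
      rw [e2, e1, LinearPMap.map_zero, map_zero, sub_zero, enorm_zero]
      exact zero_le
    · have hn : ‖ξ‖ ≠ 0 := norm_ne_zero_iff.2 h0
      set c : ℂ := ((‖ξ‖⁻¹ : ℝ) : ℂ) with hc
      have hcn : ‖c‖ = ‖ξ‖⁻¹ := by rw [hc, Complex.norm_real, norm_inv, norm_norm]
      set η : T.D.domain := c • ⟨ξ, hd⟩ with hη
      have hη1 : ‖(η : T.H)‖ ≤ 1 := by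
        rw [hη, Submodule.coe_smul, norm_smul, hcn, inv_mul_cancel₀ hn]
      have e1 : T.D η = c • T.D ⟨ξ, hd⟩ := T.D.map_smul c ⟨ξ, hd⟩
      have e2 : (⟨T.rep a η, h.2 η⟩ : T.D.domain) = c • ⟨T.rep a ξ, h.2 ⟨ξ, hd⟩⟩ :=
        Subtype.ext ((T.rep a).map_smul c ξ)
      have h1 : ‖T.D ⟨T.rep a η, h.2 η⟩ - T.rep a (T.D η)‖ₑ ≤
          commutatorSeminorm T.rep T.D a := by
        rw [hL]
        exact le_iSup₂ (f := fun (ξ : T.D.domain) (_ : ‖(ξ : T.H)‖ ≤ 1) =>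
          ‖T.D ⟨T.rep a ξ, h.2 ξ⟩ - T.rep a (T.D ξ)‖ₑ) η hη1
      rw [e2, LinearPMap.map_smul, e1, map_smul, ← smul_sub, enorm_smul] at h1
      calc _ = ‖c‖ₑ * ‖T.D ⟨T.rep a ξ, h.2 ⟨ξ, hd⟩⟩ - T.rep a (T.D ⟨ξ, hd⟩)‖ₑ * ‖ξ‖ₑ := by
            have : ‖c‖ₑ * ‖ξ‖ₑ = 1 := by
              rw [enorm_eq_nnnorm, enorm_eq_nnnorm, ← ENNReal.coe_mul, ENNReal.coe_eq_one]
              ext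
              push_cast
              rw [hcn, inv_mul_cancel₀ hn]
            rw [mul_right_comm, this, one_mul]
        _ ≤ _ := by gcongr
  rw [T.graphNorm_of_mem hd, T.graphNorm_of_mem (h.2 ⟨ξ, hd⟩)]
  have hG : (1 : ℝ≥0∞) ≤ Λ.G := by exact_mod_cast Λ.one_le_G
  set L := commutatorSeminorm T.rep T.D a
  have h2 : ‖T.D ⟨T.rep a ξ, h.2 ⟨ξ, hd⟩⟩‖ₑ ≤ L * ‖ξ‖ₑ + ‖a‖ₑ * ‖T.D ⟨ξ, hd⟩‖ₑ := by
    calc _ = ‖(T.D ⟨T.rep a ξ, h.2 ⟨ξ, hd⟩⟩ - T.rep a (T.D ⟨ξ, hd⟩)) + T.rep a (T.D ⟨ξ, hd⟩)‖ₑ := by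
          rw [sub_add_cancel]
      _ ≤ _ := (enorm_add_le _ _).trans (add_le_add hcomm (hrep _))
  calc _ ≤ ‖a‖ₑ * ‖ξ‖ₑ + (L * ‖ξ‖ₑ + ‖a‖ₑ * ‖T.D ⟨ξ, hd⟩‖ₑ) := add_le_add (hrep ξ) h2
    _ ≤ ‖a‖ₑ * ‖ξ‖ₑ + (L * ‖ξ‖ₑ + ‖a‖ₑ * ‖T.D ⟨ξ, hd⟩‖ₑ) + L * ‖T.D ⟨ξ, hd⟩‖ₑ := le_self_add
    _ = 1 * (‖a‖ₑ + L) * (‖ξ‖ₑ + ‖T.D ⟨ξ, hd⟩‖ₑ) := by ring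
    _ ≤ _ := by gcongr

/-- The metrical C*-correspondence `(H, ‖·‖ + ‖D ·‖, A, ‖[D, ·]‖, ℂ, 0)`. -/
def mcc : MetricalCorrespondence.{u, v, 0} Λ where
  M := T.H
  A := T.A
  B := ℂ
  instModule := Module.compHom T.H ((RingEquiv.toOpposite ℂ).symm : ℂᵐᵒᵖ →+* ℂ)
  inner ξ η := inner ℂ ξ η
  inner_add_right := inner_add_right
  inner_smul_right z ξ η := inner_smul_right ξ η z
  inner_op_smul_right b ξ η := (inner_smul_right ξ η b).trans (mul_comm _ _)
  star_inner ξ η := inner_conj_symm ξ η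
  inner_self_nonneg ξ := ⟨(‖ξ‖ : ℂ), by
    rw [inner_self_eq_norm_sq_to_K, sq]
    exact congrArg (· * (‖ξ‖ : ℂ)) (Complex.conj_ofReal ‖ξ‖).symm⟩
  inner_self_eq_zero ξ := inner_self_eq_zero
  norm_eq_sqrt ξ := by
    rw [inner_self_eq_norm_sq_to_K, norm_pow, RCLike.norm_ofReal, abs_norm,
      Real.sqrt_sq (norm_nonneg _)]
  act := AlgHom.mk' (ContinuousLinearMap.toLinearMapRingHom.comp (T.rep : T.A →+* (T.H →L[ℂ] T.H)))
    fun z a => by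
      ext ξ
      change T.rep (z • a) ξ = z • T.rep a ξ
      rw [map_smul]
      rfl
  inner_act_left a ξ η := by
    change inner ℂ (T.rep a ξ) η = inner ℂ ξ (T.rep (star a) η)
    rw [map_star, ContinuousLinearMap.star_eq_adjoint, ContinuousLinearMap.adjoint_inner_right]
  lip := commutatorSeminorm T.rep T.D
  slip := trivialSeminorm
  dnorm := graphNorm T.D
  lip_isQCMS := T.metric
  slip_isQCMS := trivialSeminorm_isQCMS _ _
  dnorm_smul := T.graphNorm_smul
  dnorm_add_le := T.graphNorm_add_le
  dnorm_dense := T.dense_graphNorm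
  norm_le_dnorm := T.enorm_le_graphNorm
  isCompact := T.isCompact_graphNorm
  modular_leibniz a ξ := T.graphNorm_rep_le a ξ
  inner_leibniz_re ξ η _ _ := by
    rw [trivialSeminorm_of_isSelfAdjoint (ℜ _).2]
    exact zero_le
  inner_leibniz_im ξ η _ _ := by
    rw [trivialSeminorm_of_isSelfAdjoint (ℑ _).2]
    exact zero_le

/-- A bounded operator on `H`, as an adjointable operator on the Hilbert module `H` over `ℂ`. -/
def toAdjointable (S : T.H →L[ℂ] T.H) : T.mcc.AdjointableOperator where
  op := S
  map_op_smul b ξ := S.map_smul (b : ℂ) (ξ : T.H)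
  adjointable := by
    let S' : T.H →L[ℂ] T.H := ContinuousLinearMap.adjoint S
    have h : ∀ ξ η : T.H, inner ℂ (S ξ) η = inner ℂ ξ (S' η) := fun ξ η =>
      (ContinuousLinearMap.adjoint_inner_right S ξ η).symm
    exact ⟨S', h⟩

end MetricSpectralTriple

/-! ### The spectral propinquity -/

/-- `(ς₁, ς₂)` is an `ε`-iso-iso of `[0, ∞)`. -/
structure IsIsoIso (ε : ℝ) (ς₁ ς₂ : ℝ≥0 → ℝ≥0) : Prop where
  zero_left : ς₁ 0 = 0
  zero_right : ς₂ 0 = 0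
  left : ∀ x y z : ℝ≥0, (x : ℝ) ≤ 1 / ε → (y : ℝ) ≤ 1 / ε → (z : ℝ) ≤ 1 / ε →
    abs (|(ς₁ x : ℝ) + ς₁ y - z| - |(x : ℝ) + y - ς₂ z|) < ε
  right : ∀ x y z : ℝ≥0, (x : ℝ) ≤ 1 / ε → (y : ℝ) ≤ 1 / ε → (z : ℝ) ≤ 1 / ε →
    abs (|(ς₂ x : ℝ) + ς₂ y - z| - |(x : ℝ) + y - ς₁ z|) < ε

section Spectral

variable {Λ : LeibnizConstants} {T₁ T₂ : MetricSpectralTriple.{u, v} Λ}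

/-- The directed Hausdorff distance between the orbits
`(⟨U₁^{-t} ξ, Π₁(·)⟩)_{0 ≤ t ≤ 1/ε}` and `(⟨U₂^{-ς t} η, Π₂(·)⟩)_{0 ≤ t ≤ 1/ε}`, with `ξ` and `η`
in the unit balls of the graph norms. -/
def Tunnel.halfReach (τ : Tunnel T₁.mcc T₂.mcc) (ς : ℝ≥0 → ℝ≥0) (ε : ℝ) : ℝ≥0∞ :=
  directedHausdorff (kantorovichFamily τ.P.dnorm)
    {g : {t : ℝ≥0 // (t : ℝ) ≤ 1 / ε} → τ.P.M → ℂ | ∃ ξ : T₁.H, graphNorm T₁.D ξ ≤ 1 ∧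
      g = fun t ω => inner ℂ (T₁.U (-(t.1 : ℝ)) ξ) (τ.left.mapM ω : T₁.H)}
    {g : {t : ℝ≥0 // (t : ℝ) ≤ 1 / ε} → τ.P.M → ℂ | ∃ η : T₂.H, graphNorm T₂.D η ≤ 1 ∧
      g = fun t ω => inner ℂ (T₂.U (-(ς t.1 : ℝ)) η) (τ.right.mapM ω : T₂.H)}

/-- The `ε`-reach of `(τ, ς₁, ς₂)`. -/
def Tunnel.reach (τ : Tunnel T₁.mcc T₂.mcc) (ς₁ ς₂ : ℝ≥0 → ℝ≥0) (ε : ℝ) : ℝ≥0∞ :=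
  max (τ.halfReach ς₁ ε) (τ.symm.halfReach ς₂ ε)

/-- The `ε`-magnitude of `(τ, ς₁, ς₂)`. -/
def Tunnel.magnitude (τ : Tunnel T₁.mcc T₂.mcc) (ς₁ ς₂ : ℝ≥0 → ℝ≥0) (ε : ℝ) : ℝ≥0∞ :=
  max τ.extent (τ.reach ς₁ ς₂ ε)

/-- The spectral propinquity between two metric spectral triples. -/
def spectralPropinquity (T₁ T₂ : MetricSpectralTriple.{u, v} Λ) : ℝ :=
  sInf ({√2 / 2} ∪ {ε : ℝ | 0 < ε ∧ ∃ (τ : Tunnel T₁.mcc T₂.mcc) (ς₁ ς₂ : ℝ≥0 → ℝ≥0),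
    IsIsoIso ε ς₁ ς₂ ∧ τ.magnitude ς₁ ς₂ ε < ENNReal.ofReal ε})

end Spectral

end

namespace MetricSpectralTriple

variable {Λ : LeibnizConstants} (T : MetricSpectralTriple.{u, v} Λ)

/-! ### Algebraic properties of the functional calculus of the Dirac operator -/

/-! The spectral propinquity controls the orbits of the unitary groups `exp(itD)`, and a
trigonometric polynomial in `D` is a linear combination of such unitaries, so the theorem is clear
for trigonometric polynomials. A bounded continuous `f` is in general no uniform limit of these on
the line. Uniformity is not needed, however: a pseudo-state composed with `f(D)` is tested only on
images of vectors of D-norm at most 1, and these have graph norm at most 1. For such a vector, an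
error bounded by `δ(1 + |x|)` costs at most `2δ` in norm, whatever the triple
(`norm_funcCalc_le_graph`). With this weight every `f` can be approximated
(`exists_sum_expFun_approx`): truncate, periodize, use Fourier series on a circle, and let the
weight absorb what happens far away.

The orbits are compared as follows. An iso-iso is within `ε` of the identity on `[0, 1/ε]`, and `t ↦
exp(itD)ξ` is 2-Lipschitz when `ξ` has graph norm at most 1, so orbits close along `ς` are close at
equal times. Only times in `[0, 1/ε]` are given. Since the unitaries preserve the unit ball of the
graph norm, translating the origin of time to the middle of this interval gives closeness for `|t| ≤
1/(2ε)`, with one partner `η` for all times (`Tunnel.exists_orbit_close_two_sided`).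

The tunnel that witnesses spectral closeness thus yields an operational distance at most the maximum
of `ε` and `4δ + 3ε ∑ |c_n|`. The coefficients and frequencies depend on `f` and `δ` only, so `δ` is
fixed first and `ε` is then made small. -/

theorem hasSum_funcCalc (f : ℝ →ᵇ ℂ) (ξ : T.H) :
    HasSum (fun x : ℝ => f x • T.eigenproj x ξ) (T.funcCalc f ξ) :=
  (T.summable_eigenproj f ξ).hasSum

theorem eigenproj_mem_domain (x : ℝ) (ξ : T.H) : T.eigenproj x ξ ∈ T.D.domain :=
  (T.mem_eigenspace.1 (Submodule.starProjection_apply_mem (T.eigenspace x) ξ)).1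

theorem D_eigenproj (x : ℝ) (ξ : T.H) :
    T.D ⟨T.eigenproj x ξ, T.eigenproj_mem_domain x ξ⟩ = (x : ℂ) • T.eigenproj x ξ :=
  (T.mem_eigenspace.1 (Submodule.starProjection_apply_mem (T.eigenspace x) ξ)).2

theorem inner_eigenproj_left (x : ℝ) (ξ η : T.H) :
    inner ℂ (T.eigenproj x ξ) η = inner ℂ ξ (T.eigenproj x η) :=
  Submodule.inner_starProjection_left_eq_right (T.eigenspace x) ξ η

/-- Both operators are moved across the inner product, where `D` meets a vector of its own
eigenspace. This identity later trades a factor `x` for an application of `D`. -/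
theorem eigenproj_D (x : ℝ) (ξ : T.D.domain) :
    T.eigenproj x (T.D ξ) = (x : ℂ) • T.eigenproj x (ξ : T.H) := by
  refine ext_inner_left ℂ fun η => ?_
  rw [← T.inner_eigenproj_left, ← T.inner_D ⟨_, T.eigenproj_mem_domain x η⟩ ξ, T.D_eigenproj,
    inner_smul_left, inner_smul_right, T.inner_eigenproj_left, Complex.conj_ofReal]

theorem eigenproj_eigenproj (x y : ℝ) (ξ : T.H) :
    T.eigenproj y (T.eigenproj x ξ) = if x = y then T.eigenproj y ξ else 0 := by
  split_ifs with h
  · subst h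
    exact Submodule.starProjection_eq_self_iff.2 (Submodule.starProjection_apply_mem _ _)
  · refine ext_inner_left ℂ fun η => ?_
    rw [← T.inner_eigenproj_left, inner_zero_right]
    exact T.orthogonalFamily (Ne.symm h)
      ⟨_, Submodule.starProjection_apply_mem (T.eigenspace y) η⟩
      ⟨_, Submodule.starProjection_apply_mem (T.eigenspace x) ξ⟩

/-- Distinct eigenspaces are orthogonal, so a single term of the series survives. The product rule
for the calculus then becomes a termwise comparison of series. -/
theorem eigenproj_funcCalc (f : ℝ →ᵇ ℂ) (y : ℝ) (ξ : T.H) :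
    T.eigenproj y (T.funcCalc f ξ) = f y • T.eigenproj y ξ := by
  have h := (T.eigenproj y).hasSum (T.hasSum_funcCalc f ξ)
  have h2 : HasSum (fun x : ℝ => T.eigenproj y (f x • T.eigenproj x ξ))
      (f y • T.eigenproj y ξ) := by
    convert hasSum_single y fun x hx => ?_ using 1
    · rw [map_smul, T.eigenproj_eigenproj, if_pos rfl]
    · rw [map_smul, T.eigenproj_eigenproj, if_neg hx, smul_zero]
  exact h.unique h2

theorem funcCalc_funcCalc (f g : ℝ →ᵇ ℂ) (ξ : T.H) :
    T.funcCalc f (T.funcCalc g ξ) = T.funcCalc (f * g) ξ := by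
  refine (T.hasSum_funcCalc f _).unique ?_
  convert T.hasSum_funcCalc (f * g) ξ using 2 with x
  rw [T.eigenproj_funcCalc, smul_smul, BoundedContinuousFunction.mul_apply]

theorem funcCalc_sub (f g : ℝ →ᵇ ℂ) (ξ : T.H) :
    T.funcCalc (f - g) ξ = T.funcCalc f ξ - T.funcCalc g ξ := by
  refine (T.hasSum_funcCalc _ _).unique ?_
  convert (T.hasSum_funcCalc f ξ).sub (T.hasSum_funcCalc g ξ) using 2 with x
  rw [BoundedContinuousFunction.sub_apply, sub_smul]

theorem funcCalc_sum {ι : Type*} (s : Finset ι) (c : ι → ℂ) (g : ι → ℝ →ᵇ ℂ) (ξ : T.H) :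
    T.funcCalc (∑ i ∈ s, c i • g i) ξ = ∑ i ∈ s, c i • T.funcCalc (g i) ξ := by
  refine (T.hasSum_funcCalc _ _).unique ?_
  convert hasSum_sum fun i (_ : i ∈ s) => (T.hasSum_funcCalc (g i) ξ).const_smul (c i) using 2
    with x
  rw [BoundedContinuousFunction.sum_apply, Finset.sum_smul]
  exact Finset.sum_congr rfl fun i _ => by
    rw [BoundedContinuousFunction.smul_apply, smul_assoc]

theorem inner_funcCalc_star (f : ℝ →ᵇ ℂ) (ξ η : T.H) :
    inner ℂ (T.funcCalc (star f) ξ) η = inner ℂ ξ (T.funcCalc f η) := by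
  have h1 : HasSum (fun x : ℝ => inner ℂ (star f x • T.eigenproj x ξ) η)
      (inner ℂ (T.funcCalc (star f) ξ) η) :=
    (T.hasSum_funcCalc (star f) ξ).map ((innerₛₗ ℂ).flip η)
      (continuous_id.inner continuous_const)
  have h2 : HasSum (fun x : ℝ => inner ℂ ξ (f x • T.eigenproj x η))
      (inner ℂ ξ (T.funcCalc f η)) := (T.hasSum_funcCalc f η).mapL (innerSL ℂ ξ)
  refine h1.unique ?_
  convert h2 using 2 with x
  rw [inner_smul_left, inner_smul_right, T.inner_eigenproj_left,
    BoundedContinuousFunction.star_apply, ← starRingEnd_apply, Complex.conj_conj]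

/-- Each partial sum lies in the graph because the eigenprojections commute with `D`; the graph of a
self-adjoint operator is closed, so the limit stays in it. -/
theorem funcCalc_mem_graph (f : ℝ →ᵇ ℂ) (ξ : T.D.domain) :
    (T.funcCalc f ξ, T.funcCalc f (T.D ξ)) ∈ T.D.graph := by
  have hcl : IsClosed (T.D.graph : Set (T.H × T.H)) := T.isSelfAdjoint.isClosed
  have h := (T.hasSum_funcCalc f ξ).prodMk (T.hasSum_funcCalc f (T.D ξ))
  refine hcl.mem_of_tendsto h (Filter.Eventually.of_forall fun s => ?_)
  refine Submodule.sum_mem _ fun x _ => ?_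
  have h1 : (f x • T.eigenproj x (ξ : T.H), f x • T.eigenproj x (T.D ξ)) =
      f x • (T.eigenproj x (ξ : T.H), T.eigenproj x (T.D ξ)) := rfl
  rw [h1, T.eigenproj_D, ← T.D_eigenproj]
  exact Submodule.smul_mem _ _ (T.D.mem_graph ⟨_, T.eigenproj_mem_domain x ξ⟩)

theorem norm_funcCalc_apply_le (f : ℝ →ᵇ ℂ) (ξ : T.H) : ‖T.funcCalc f ξ‖ ≤ ‖f‖ * ‖ξ‖ :=
  le_of_tendsto (T.hasSum_funcCalc f ξ).norm
    (Filter.Eventually.of_forall fun s => T.norm_sum_eigenproj_le f s ξ)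

/-- `f(D)` commutes with `D`, so a contraction for the Hilbert norm is one for the graph norm. It
lets the unitaries act inside the unit ball that defines the pseudo-states. -/
theorem graphNorm_funcCalc_le {f : ℝ →ᵇ ℂ} (hf : ‖f‖ ≤ 1) {ξ : T.H} (hξ : graphNorm T.D ξ ≤ 1) :
    graphNorm T.D (T.funcCalc f ξ) ≤ 1 := by
  have hd : ξ ∈ T.D.domain := T.mem_domain_of_graphNorm (lt_of_le_of_lt hξ ENNReal.one_lt_top)
  obtain ⟨y, hy1, hy2⟩ := (LinearPMap.mem_graph_iff _).1 (T.funcCalc_mem_graph f ⟨ξ, hd⟩)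
  have hy : T.funcCalc f ξ ∈ T.D.domain := by
    have := y.2
    rwa [hy1] at this
  have hy3 : T.D ⟨T.funcCalc f ξ, hy⟩ = T.funcCalc f (T.D ⟨ξ, hd⟩) := by
    exact (congrArg T.D (Subtype.ext hy1.symm)).trans hy2
  rw [T.graphNorm_le_one_iff hd] at hξ
  rw [T.graphNorm_le_one_iff hy, hy3]
  have h1 : ∀ ζ : T.H, ‖T.funcCalc f ζ‖ ≤ ‖ζ‖ := fun ζ =>
    (T.norm_funcCalc_apply_le f ζ).trans (mul_le_of_le_one_left (norm_nonneg _) hf)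
  linarith [h1 ξ, h1 (T.D ⟨ξ, hd⟩)]

/-- If `|f x| ≤ C (1 + |x|)` then `‖f(D) ξ‖` is controlled by the graph norm. -/
theorem norm_funcCalc_le_graph {f : ℝ →ᵇ ℂ} {C : ℝ} (hC : 0 ≤ C)
    (hf : ∀ x, ‖f x‖ ≤ C * (1 + |x|)) (ξ : T.D.domain) :
    ‖T.funcCalc f ξ‖ ≤ 2 * C * (‖(ξ : T.H)‖ + ‖T.D ξ‖) := by
  refine le_of_tendsto (T.hasSum_funcCalc f ξ).norm (Filter.Eventually.of_forall fun s => ?_)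
  refine le_of_sq_le_sq ?_ (by positivity)
  rw [T.norm_sq_sum_eigenproj]
  have hx : ∀ x ∈ s, ‖f x • T.eigenproj x (ξ : T.H)‖ ^ 2 ≤
      2 * C ^ 2 * (‖T.eigenproj x (ξ : T.H)‖ ^ 2 + ‖T.eigenproj x (T.D ξ)‖ ^ 2) := fun x _ => by
    -- The growth `|x|` allowed to `f` is absorbed here: `x Pₓξ = Pₓ(Dξ)`. Bessel's inequality is
    -- then applied to both `ξ` and `Dξ`.
    rw [T.eigenproj_D, norm_smul, norm_smul, Complex.norm_real, Real.norm_eq_abs]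
    have h1 : ‖f x‖ ^ 2 ≤ 2 * C ^ 2 * (1 + |x| ^ 2) := by
      calc ‖f x‖ ^ 2 ≤ (C * (1 + |x|)) ^ 2 := by gcongr; exact hf x
        _ ≤ _ := by nlinarith [mul_nonneg (sq_nonneg C) (sq_nonneg (1 - |x|))]
    calc (‖f x‖ * ‖T.eigenproj x (ξ : T.H)‖) ^ 2
        = ‖f x‖ ^ 2 * ‖T.eigenproj x (ξ : T.H)‖ ^ 2 := mul_pow _ _ _
      _ ≤ 2 * C ^ 2 * (1 + |x| ^ 2) * ‖T.eigenproj x (ξ : T.H)‖ ^ 2 := by gcongr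
      _ = _ := by ring
  calc _ ≤ ∑ x ∈ s, 2 * C ^ 2 *
        (‖T.eigenproj x (ξ : T.H)‖ ^ 2 + ‖T.eigenproj x (T.D ξ)‖ ^ 2) := Finset.sum_le_sum hx
    _ ≤ 2 * C ^ 2 * (‖(ξ : T.H)‖ ^ 2 + ‖T.D ξ‖ ^ 2) := by
      rw [← Finset.mul_sum, Finset.sum_add_distrib]
      gcongr
      · exact T.sum_norm_sq_eigenproj_le s ξ
      · exact T.sum_norm_sq_eigenproj_le s (T.D ξ)
    _ ≤ _ := by
      have h1 := mul_nonneg (sq_nonneg C) (mul_nonneg (norm_nonneg (ξ : T.H)) (norm_nonneg (T.D ξ)))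
      have h2 := mul_nonneg (sq_nonneg C) (add_nonneg (sq_nonneg ‖(ξ : T.H)‖) (sq_nonneg ‖T.D ξ‖))
      nlinarith

theorem norm_funcCalc_le_of_graphNorm_le_one {f : ℝ →ᵇ ℂ} {C : ℝ} (hC : 0 ≤ C)
    (hf : ∀ x, ‖f x‖ ≤ C * (1 + |x|)) {ξ : T.H} (hξ : graphNorm T.D ξ ≤ 1) :
    ‖T.funcCalc f ξ‖ ≤ 2 * C := by
  have hd : ξ ∈ T.D.domain := T.mem_domain_of_graphNorm (lt_of_le_of_lt hξ ENNReal.one_lt_top)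
  exact (T.norm_funcCalc_le_graph hC hf ⟨ξ, hd⟩).trans
    (mul_le_of_le_one_right (by positivity) ((T.graphNorm_le_one_iff hd).1 hξ))

theorem norm_le_one_of_graphNorm_le_one {ξ : T.H} (hξ : graphNorm T.D ξ ≤ 1) : ‖ξ‖ ≤ 1 := by
  have h := (T.enorm_le_graphNorm ξ).trans hξ
  rw [enorm_eq_nnnorm] at h
  exact_mod_cast h

/-! ### The unitary group of the Dirac operator -/

theorem expFun_apply (t x : ℝ) : expFun t x = Complex.exp (Complex.I * t * x) := rfl

theorem norm_expFun_le (t : ℝ) : ‖expFun t‖ ≤ 1 :=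
  (BoundedContinuousFunction.norm_le zero_le_one).2 fun x => (norm_exp_I_mul t x).le

theorem U_U (s t : ℝ) (ξ : T.H) : T.U s (T.U t ξ) = T.U (s + t) ξ := by
  have h : expFun s * expFun t = expFun (s + t) := by
    ext x
    rw [BoundedContinuousFunction.mul_apply, expFun_apply, expFun_apply, expFun_apply,
      ← Complex.exp_add]
    push_cast
    ring_nf
  rw [U, U, U, T.funcCalc_funcCalc, h]

theorem inner_U_neg (t : ℝ) (ξ η : T.H) :
    inner ℂ (T.U (-t) ξ) η = inner ℂ ξ (T.U t η) := by
  have h : expFun (-t) = star (expFun t) := by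
    ext x
    rw [BoundedContinuousFunction.star_apply, expFun_apply, expFun_apply, ← starRingEnd_apply,
      ← Complex.exp_conj]
    simp
  rw [U, h, T.inner_funcCalc_star, U]

theorem graphNorm_U_le (t : ℝ) {ξ : T.H} (hξ : graphNorm T.D ξ ≤ 1) :
    graphNorm T.D (T.U t ξ) ≤ 1 :=
  T.graphNorm_funcCalc_le (norm_expFun_le t) hξ

theorem norm_expFun_sub_le (s t x : ℝ) : ‖expFun s x - expFun t x‖ ≤ |s - t| * |x| := by
  have h : expFun s x - expFun t x =
      Complex.exp (Complex.I * t * x) * (Complex.exp (Complex.I * ((s - t) * x : ℝ)) - 1) := by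
    rw [expFun_apply, expFun_apply, mul_sub, ← Complex.exp_add, mul_one]
    push_cast
    ring_nf
  rw [h, norm_mul, norm_exp_I_mul, one_mul, ← abs_mul]
  exact Real.norm_exp_I_mul_ofReal_sub_one_le

/-- The difference of the exponentials is at most `|s - t| |x|`, which is within the weight `1 +
|x|`. The Lipschitz constant 2 is the same for all triples. -/
theorem norm_U_sub_le (s t : ℝ) {ξ : T.H} (hξ : graphNorm T.D ξ ≤ 1) :
    ‖T.U s ξ - T.U t ξ‖ ≤ 2 * |s - t| := by
  rw [U, U, ← T.funcCalc_sub]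
  refine T.norm_funcCalc_le_of_graphNorm_le_one (abs_nonneg _) (fun x => ?_) hξ
  rw [BoundedContinuousFunction.sub_apply]
  refine (norm_expFun_sub_le s t x).trans ?_
  gcongr
  linarith

end MetricSpectralTriple

/-! ### Weighted approximation by trigonometric polynomials -/

/-- A bounded continuous function on the line coincides on `[-N, N]` with a continuous periodic
function with the same bound. -/
theorem BoundedContinuousFunction.exists_periodic_eqOn (f : ℝ →ᵇ ℂ) {N : ℝ} (hN : 0 < N) :
    ∃ g : C(AddCircle (2 * (N + 1)), ℂ), (∀ x : ℝ, |x| ≤ N → g x = f x) ∧ ∀ y, ‖g y‖ ≤ ‖f‖ := by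
  have hp : 0 < 2 * (N + 1) := by linarith
  have : Fact (0 < 2 * (N + 1)) := ⟨hp⟩
  -- A trapezoidal cutoff, equal to 1 on `[-N, N]` and to 0 at `±(N + 1)`: the truncated function
  -- takes equal values at the two ends of a period and descends to the circle.
  let χ : ℝ → ℝ := fun x => max 0 (min 1 (N + 1 - |x|))
  have hχ0 : ∀ x, 0 ≤ χ x := fun x => le_max_left _ _
  have hχ1 : ∀ x, χ x ≤ 1 := fun x => max_le zero_le_one (min_le_left _ _)
  have hχN : ∀ x, |x| ≤ N → χ x = 1 := fun x hx => by
    simp only [χ]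
    rw [min_eq_left (by linarith), max_eq_right zero_le_one]
  have hχb : ∀ x, |x| = N + 1 → χ x = 0 := fun x hx => by
    simp only [χ]
    rw [hx, sub_self, min_eq_right zero_le_one, max_self]
  let F : ℝ → ℂ := fun x => (χ x : ℂ) * f x
  have hFc : Continuous F := by
    have : Continuous χ := by fun_prop
    exact (Complex.continuous_ofReal.comp this).mul f.continuous
  have hF : ∀ x, ‖F x‖ ≤ ‖f‖ := fun x => by
    rw [norm_mul, Complex.norm_real, Real.norm_of_nonneg (hχ0 x)]
    exact (mul_le_of_le_one_left (norm_nonneg _) (hχ1 x)).trans (f.norm_coe_le_norm x)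
  have hend : F (-(N + 1)) = F (-(N + 1) + 2 * (N + 1)) := by
    have h1 : -(N + 1) + 2 * (N + 1) = N + 1 := by ring
    simp only [F]
    rw [h1, hχb (-(N + 1)) (by rw [abs_neg, abs_of_pos (by linarith)]),
      hχb (N + 1) (abs_of_pos (by linarith))]
    simp
  refine ⟨⟨AddCircle.liftIco (2 * (N + 1)) (-(N + 1)) F,
    AddCircle.liftIco_continuous hend hFc.continuousOn⟩, fun x hx => ?_, fun y => ?_⟩
  · have hx' := abs_le.1 hx
    change AddCircle.liftIco (2 * (N + 1)) (-(N + 1)) F x = f x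
    rw [AddCircle.liftIco_coe_apply ⟨by linarith, by linarith⟩]
    simp only [F]
    rw [hχN x hx, Complex.ofReal_one, one_mul]
  · exact hF _

/-- A bounded continuous function is approximated by trigonometric polynomials, with respect to the
weight `1 + |x|`. -/
theorem exists_sum_expFun_approx (f : ℝ →ᵇ ℂ) {δ : ℝ} (hδ : 0 < δ) :
    ∃ (s : Finset ℤ) (c : ℤ → ℂ) (t : ℤ → ℝ), ∀ x : ℝ,
      ‖(f - ∑ n ∈ s, c n • MetricSpectralTriple.expFun (t n)) x‖ ≤ δ * (1 + |x|) := by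
  -- Beyond `N` the trivial bound `2‖f‖` on the error is already below `δ|x|`. The `+ 1` in the
  -- witness keeps `N` positive when `f = 0`.
  obtain ⟨N, hN, hNf⟩ : ∃ N : ℝ, 0 < N ∧ 2 * ‖f‖ ≤ δ * N :=
    ⟨2 * ‖f‖ / δ + 1, by positivity, by
      rw [mul_add, mul_div_cancel₀ _ hδ.ne']
      linarith⟩
  obtain ⟨g, hg, hgf⟩ := f.exists_periodic_eqOn hN
  have : Fact (0 < 2 * (N + 1)) := ⟨by linarith⟩
  have hmem : g ∈ (Submodule.span ℂ
      (Set.range (fourier (T := 2 * (N + 1))))).topologicalClosure := by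
    rw [span_fourier_closure_eq_top]
    trivial
  obtain ⟨p, hp, hgp⟩ := Metric.mem_closure_iff.1 hmem δ hδ
  obtain ⟨c, rfl⟩ := Finsupp.mem_span_range_iff_exists_finsupp.1 hp
  refine ⟨c.support, c, fun n => 2 * Real.pi * n / (2 * (N + 1)), fun x => ?_⟩
  have hpx : (∑ n ∈ c.support, c n • MetricSpectralTriple.expFun
      (2 * Real.pi * n / (2 * (N + 1)))) x =
      (c.sum fun n a => a • fourier (T := 2 * (N + 1)) n) (x : AddCircle (2 * (N + 1))) := by
    rw [BoundedContinuousFunction.sum_apply, Finsupp.sum, ContinuousMap.sum_apply]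
    refine Finset.sum_congr rfl fun n _ => ?_
    rw [BoundedContinuousFunction.smul_apply, ContinuousMap.smul_apply, fourier_coe_apply,
      MetricSpectralTriple.expFun_apply]
    congr 2
    push_cast
    ring
  rw [BoundedContinuousFunction.sub_apply, hpx]
  set q := c.sum fun n a => a • fourier (T := 2 * (N + 1)) n
  -- Both functions are periodic, so the uniform estimate on the circle holds on the whole line;
  -- only `f - g` needs the weight.
  have h1 : ‖g x - q x‖ ≤ δ := by
    rw [dist_eq_norm] at hgp
    exact ((g - q).norm_coe_le_norm _).trans hgp.le
  have h2 : ‖f x - q x‖ ≤ ‖f x - g x‖ + ‖g x - q x‖ := norm_sub_le_norm_sub_add_norm_sub _ _ _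
  have h3 : ‖f x - g x‖ ≤ δ * |x| := by
    rcases le_total |x| N with hx | hx
    · rw [hg x hx, sub_self, norm_zero]
      positivity
    · have h4 : ‖f x - g x‖ ≤ ‖f x‖ + ‖g x‖ := norm_sub_le _ _
      have h5 : δ * N ≤ δ * |x| := by gcongr
      linarith [f.norm_coe_le_norm x, hgf x]
  linarith

/-! ### Comparison of orbits and of functional calculi along a tunnel -/

/-- The case `x = y = 0` of the inequality for `ς₂`, which fixes 0, leaves just `|t - ς₁ t|`. -/
theorem IsIsoIso.abs_left_sub_le {ε : ℝ} {ς₁ ς₂ : ℝ≥0 → ℝ≥0} (h : IsIsoIso ε ς₁ ς₂) (hε : 0 < ε)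
    {t : ℝ≥0} (ht : (t : ℝ) ≤ 1 / ε) : |(ς₁ t : ℝ) - t| ≤ ε := by
  have h0 : ((0 : ℝ≥0) : ℝ) ≤ 1 / ε := by
    rw [NNReal.coe_zero]
    positivity
  have h1 := h.right 0 0 t h0 h0 ht
  rw [h.zero_right] at h1
  simp only [NNReal.coe_zero, add_zero, zero_sub, abs_neg, NNReal.abs_eq] at h1
  rw [abs_sub_comm]
  exact h1.le

theorem IsIsoIso.symm {ε : ℝ} {ς₁ ς₂ : ℝ≥0 → ℝ≥0} (h : IsIsoIso ε ς₁ ς₂) : IsIsoIso ε ς₂ ς₁ :=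
  ⟨h.zero_right, h.zero_left, h.right, h.left⟩

/-- `ω` itself competes in the infimum defining the quotient norm. Test vectors of a tunnel
therefore have graph norm at most 1 at both ends. -/
theorem ModularQuantumIsometry.dnorm_map_le {Λ : LeibnizConstants}
    {M₁ M₂ : MetricalCorrespondence.{u, v, w} Λ} (Φ : ModularQuantumIsometry M₁ M₂) {ω : M₁.M}
    (hω : M₁.dnorm ω ≤ 1) : M₂.dnorm (Φ.mapM ω) ≤ 1 := by
  rw [Φ.dnorm_eq _ (Φ.dnorm_lt_top ω (lt_of_le_of_lt hω ENNReal.one_lt_top))]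
  exact (iInf₂_le (f := fun η (_ : Φ.mapM η = Φ.mapM ω) => M₁.dnorm η) ω rfl).trans hω

theorem exists_of_directedHausdorff_lt {X : Type*} {d : X → X → ℝ≥0∞} {A B : Set X} {r : ℝ≥0∞}
    (h : directedHausdorff d A B < r) {x : X} (hx : x ∈ A) : ∃ y ∈ B, d x y < r := by
  have h1 : ⨅ y ∈ B, d x y < r :=
    lt_of_le_of_lt (le_iSup₂ (f := fun x (_ : x ∈ A) => ⨅ y ∈ B, d x y) x hx) h
  simpa only [iInf_lt_iff, exists_prop] using h1

theorem norm_sub_le_of_kantorovichFamily_le {E J : Type*} {N : E → ℝ≥0∞} {φ ψ : J → E → ℂ} {r : ℝ}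
    (hr : 0 ≤ r) (h : kantorovichFamily N φ ψ ≤ ENNReal.ofReal r) (j : J) {x : E} (hx : N x ≤ 1) :
    ‖φ j x - ψ j x‖ ≤ r := by
  have h1 : ‖φ j x - ψ j x‖ₑ ≤ ENNReal.ofReal r :=
    ((le_iSup₂ (f := fun x (_ : N x ≤ 1) => ‖φ j x - ψ j x‖ₑ) x hx).trans
      (le_iSup (fun j => kantorovich N (φ j) (ψ j)) j)).trans h
  rwa [← ofReal_norm, ENNReal.ofReal_le_ofReal_iff hr] at h1

namespace MetricSpectralTriple

variable {Λ : LeibnizConstants} (T : MetricSpectralTriple.{u, v} Λ)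

/-- The identity is the only state of `ℂ`, so pseudo-states reduce to the vector functionals used in
the spectral propinquity. -/
theorem mem_pseudoStates_iff {φ : T.H → ℂ} :
    φ ∈ T.mcc.pseudoStates ↔ ∃ ξ : T.H, graphNorm T.D ξ ≤ 1 ∧ φ = fun η => inner ℂ ξ η := by
  have hid : ∀ μ ∈ stateSpace ℂ, ∀ z : ℂ, μ z = z := fun μ hμ z => by
    have h1 : μ (z • 1) = z • μ 1 := map_smul μ z 1
    rw [hμ.1] at h1
    simpa using h1
  constructor
  · rintro ⟨μ, hμ, ξ, hξ, rfl⟩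
    exact ⟨ξ, hξ, funext fun η => hid μ hμ _⟩
  · rintro ⟨ξ, hξ, rfl⟩
    refine ⟨(ContinuousLinearMap.id ℂ ℂ : ℂ →L[ℂ] ℂ), ⟨rfl, fun a => ?_⟩, ξ, hξ, rfl⟩
    exact star_mul_self_nonneg (R := ℂ) a

end MetricSpectralTriple

section Comparison

variable {Λ : LeibnizConstants} {T₁ T₂ : MetricSpectralTriple.{u, v} Λ}

/-- The image in the Hilbert space of the first triple of an element of the module of a tunnel. -/
noncomputable def Tunnel.leftVec (τ : Tunnel T₁.mcc T₂.mcc) (ω : τ.P.M) : T₁.H := τ.left.mapM ω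

/-- The image in the Hilbert space of the second triple of an element of the module of a tunnel. -/
noncomputable def Tunnel.rightVec (τ : Tunnel T₁.mcc T₂.mcc) (ω : τ.P.M) : T₂.H := τ.right.mapM ω

theorem Tunnel.graphNorm_leftVec_le (τ : Tunnel T₁.mcc T₂.mcc) {ω : τ.P.M}
    (hω : τ.P.dnorm ω ≤ 1) : graphNorm T₁.D (τ.leftVec ω) ≤ 1 :=
  τ.left.dnorm_map_le hω

theorem Tunnel.graphNorm_rightVec_le (τ : Tunnel T₁.mcc T₂.mcc) {ω : τ.P.M}
    (hω : τ.P.dnorm ω ≤ 1) : graphNorm T₂.D (τ.rightVec ω) ≤ 1 :=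
  τ.right.dnorm_map_le hω

/-- Orbits in positive time that are close along `ς` are close along the identity. -/
theorem Tunnel.exists_orbit_close (τ : Tunnel T₁.mcc T₂.mcc) {ς : ℝ≥0 → ℝ≥0} {ε : ℝ} (hε : 0 < ε)
    (hς : ∀ t : ℝ≥0, (t : ℝ) ≤ 1 / ε → |(ς t : ℝ) - t| ≤ ε)
    (hτ : τ.halfReach ς ε < ENNReal.ofReal ε) {ξ : T₁.H} (hξ : graphNorm T₁.D ξ ≤ 1) :
    ∃ η : T₂.H, graphNorm T₂.D η ≤ 1 ∧ ∀ t : ℝ, 0 ≤ t → t ≤ 1 / ε →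
      ∀ ω : τ.P.M, τ.P.dnorm ω ≤ 1 →
        ‖inner ℂ (T₁.U (-t) ξ) (τ.leftVec ω) -
          inner ℂ (T₂.U (-t) η) (τ.rightVec ω)‖ ≤ 3 * ε := by
  -- The supremum over times is part of the distance, inside the infimum over `η`: one `η` serves
  -- all times.
  obtain ⟨_, ⟨η, hη, rfl⟩, h⟩ := exists_of_directedHausdorff_lt hτ ⟨ξ, hξ, rfl⟩
  refine ⟨η, hη, fun t ht0 ht ω hω => ?_⟩
  have h1 : ‖inner ℂ (T₁.U (-t) ξ) (τ.leftVec ω) -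
      inner ℂ (T₂.U (-(ς ⟨t, ht0⟩ : ℝ)) η) (τ.rightVec ω)‖ ≤ ε :=
    norm_sub_le_of_kantorovichFamily_le hε.le h.le ⟨⟨t, ht0⟩, ht⟩ hω
  have hnorm : ‖(τ.rightVec ω)‖ ≤ 1 :=
    T₂.norm_le_one_of_graphNorm_le_one (τ.graphNorm_rightVec_le hω)
  have hU : ‖T₂.U (-(ς ⟨t, ht0⟩ : ℝ)) η - T₂.U (-t) η‖ ≤ 2 * ε := by
    refine (T₂.norm_U_sub_le _ _ hη).trans ?_
    have h2 := hς ⟨t, ht0⟩ ht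
    rw [← neg_sub', abs_neg]
    have h3 : |(ς ⟨t, ht0⟩ : ℝ) - t| ≤ ε := h2
    linarith
  have h2 : ‖inner ℂ (T₂.U (-(ς ⟨t, ht0⟩ : ℝ)) η) (τ.rightVec ω) -
      inner ℂ (T₂.U (-t) η) (τ.rightVec ω)‖ ≤ 2 * ε := by
    rw [← inner_sub_left]
    refine (norm_inner_le_norm _ _).trans ?_
    exact (mul_le_of_le_one_right (norm_nonneg _) hnorm).trans hU
  have h3 := norm_sub_le_norm_sub_add_norm_sub
    (inner ℂ (T₁.U (-t) ξ) (τ.leftVec ω))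
    (inner ℂ (T₂.U (-(ς ⟨t, ht0⟩ : ℝ)) η) (τ.rightVec ω))
    (inner ℂ (T₂.U (-t) η) (τ.rightVec ω))
  linarith

/-- Shifting time by `1 / (2 ε)` gives orbits that are close in positive and in negative time. -/
theorem Tunnel.exists_orbit_close_two_sided (τ : Tunnel T₁.mcc T₂.mcc) {ς : ℝ≥0 → ℝ≥0} {ε : ℝ}
    (hε : 0 < ε) (hς : ∀ t : ℝ≥0, (t : ℝ) ≤ 1 / ε → |(ς t : ℝ) - t| ≤ ε)
    (hτ : τ.halfReach ς ε < ENNReal.ofReal ε) {ξ : T₁.H} (hξ : graphNorm T₁.D ξ ≤ 1) :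
    ∃ η : T₂.H, graphNorm T₂.D η ≤ 1 ∧ ∀ t : ℝ, 2 * |t| ≤ 1 / ε →
      ∀ ω : τ.P.M, τ.P.dnorm ω ≤ 1 →
        ‖inner ℂ ξ (T₁.U t (τ.leftVec ω)) -
          inner ℂ η (T₂.U t (τ.rightVec ω))‖ ≤ 3 * ε := by
  -- The orbit is started at `exp(iD/(2ε))ξ`, so that time `1/(2ε)`, the midpoint of `[0, 1/ε]`,
  -- corresponds to `ξ`. The partner is shifted back by the same amount.
  obtain ⟨η, hη, h⟩ := τ.exists_orbit_close hε hς hτ (T₁.graphNorm_U_le (1 / ε / 2) hξ)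
  refine ⟨T₂.U (-(1 / ε / 2)) η, T₂.graphNorm_U_le _ hη, fun t ht ω hω => ?_⟩
  have ht' := abs_le.1 (show |t| ≤ 1 / ε / 2 by linarith)
  have h1 := h (t + 1 / ε / 2) (by linarith) (by linarith) ω hω
  have e1 : -(t + 1 / ε / 2) + 1 / ε / 2 = -t := by ring
  have e2 : -(t + 1 / ε / 2) = -t + -(1 / ε / 2) := by ring
  rw [T₁.U_U, e1, e2, ← T₂.U_U, T₁.inner_U_neg, T₂.inner_U_neg] at h1
  exact h1

/-- If `f` is close to a trigonometric polynomial whose frequencies are in the range where the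
orbits are close, then the functional calculi at `f` are close. -/
theorem Tunnel.directedHausdorff_funcCalc_le (τ : Tunnel T₁.mcc T₂.mcc) {ς : ℝ≥0 → ℝ≥0} {ε : ℝ}
    (hε : 0 < ε) (hς : ∀ t : ℝ≥0, (t : ℝ) ≤ 1 / ε → |(ς t : ℝ) - t| ≤ ε)
    (hτ : τ.halfReach ς ε < ENNReal.ofReal ε) (f : ℝ →ᵇ ℂ) {δ : ℝ} (hδ : 0 ≤ δ)
    {ι : Type*} (s : Finset ι) (c : ι → ℂ) (t : ι → ℝ)
    (hf : ∀ x : ℝ, ‖(f - ∑ n ∈ s, c n • MetricSpectralTriple.expFun (t n)) x‖ ≤ δ * (1 + |x|))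
    (ht : ∀ n ∈ s, 2 * |t n| ≤ 1 / ε) :
    directedHausdorff (kantorovichFamily τ.P.dnorm)
      {g : Fin 1 → τ.P.M → ℂ | ∃ φ ∈ T₁.mcc.pseudoStates,
        g = fun _ ω => φ ((T₁.toAdjointable (T₁.funcCalc f)).op (τ.left.mapM ω))}
      {g : Fin 1 → τ.P.M → ℂ | ∃ ψ ∈ T₂.mcc.pseudoStates,
        g = fun _ ω => ψ ((T₂.toAdjointable (T₂.funcCalc f)).op (τ.right.mapM ω))} ≤
      ENNReal.ofReal (4 * δ + 3 * ε * ∑ n ∈ s, ‖c n‖) := by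
  refine iSup₂_le ?_
  rintro _ ⟨φ, hφ, rfl⟩
  obtain ⟨ξ, hξ, rfl⟩ := T₁.mem_pseudoStates_iff.1 hφ
  obtain ⟨η, hη, h⟩ := τ.exists_orbit_close_two_sided hε hς hτ hξ
  refine (iInf₂_le _ ⟨_, T₂.mem_pseudoStates_iff.2 ⟨η, hη, rfl⟩, rfl⟩).trans ?_
  refine iSup_le fun _ => iSup₂_le fun ω hω => ?_
  rw [← ofReal_norm]
  refine ENNReal.ofReal_le_ofReal ?_
  set p : ℝ →ᵇ ℂ := ∑ n ∈ s, c n • MetricSpectralTriple.expFun (t n) with hp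
  -- Stated for an arbitrary triple: replacing `f` by `p` costs `2δ` at each end of the tunnel,
  -- which accounts for the `4δ`.
  have hA : ∀ (T : MetricSpectralTriple.{u, v} Λ) (ξ ζ : T.H), graphNorm T.D ξ ≤ 1 →
      graphNorm T.D ζ ≤ 1 → ‖inner ℂ ξ (T.funcCalc f ζ) - inner ℂ ξ (T.funcCalc p ζ)‖ ≤ 2 * δ := by
    intro T ξ ζ hξ hζ
    rw [← inner_sub_right, ← T.funcCalc_sub]
    refine (norm_inner_le_norm _ _).trans ?_
    exact (mul_le_of_le_one_left (norm_nonneg _) (T.norm_le_one_of_graphNorm_le_one hξ)).trans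
      (T.norm_funcCalc_le_of_graphNorm_le_one hδ hf hζ)
  have h1 := hA T₁ ξ (τ.leftVec ω) hξ (τ.graphNorm_leftVec_le hω)
  have h2 := hA T₂ η (τ.rightVec ω) hη (τ.graphNorm_rightVec_le hω)
  have h3 : ‖inner ℂ ξ (T₁.funcCalc p (τ.leftVec ω)) -
      inner ℂ η (T₂.funcCalc p (τ.rightVec ω))‖ ≤ 3 * ε * ∑ n ∈ s, ‖c n‖ := by
    rw [hp, T₁.funcCalc_sum, T₂.funcCalc_sum, inner_sum, inner_sum, ← Finset.sum_sub_distrib,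
      Finset.mul_sum]
    refine norm_sum_le_of_le _ fun n hn => ?_
    rw [inner_smul_right, inner_smul_right, ← mul_sub, norm_mul, mul_comm]
    gcongr
    exact h (t n) (ht n hn) ω hω
  change ‖inner ℂ ξ (T₁.funcCalc f (τ.leftVec ω)) -
      inner ℂ η (T₂.funcCalc f (τ.rightVec ω))‖ ≤ _
  have h4 := norm_sub_le_norm_sub_add_norm_sub
    (inner ℂ ξ (T₁.funcCalc f (τ.leftVec ω)))
    (inner ℂ ξ (T₁.funcCalc p (τ.leftVec ω)))
    (inner ℂ η (T₂.funcCalc f (τ.rightVec ω)))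
  have h5 := norm_sub_le_norm_sub_add_norm_sub
    (inner ℂ ξ (T₁.funcCalc p (τ.leftVec ω)))
    (inner ℂ η (T₂.funcCalc p (τ.rightVec ω)))
    (inner ℂ η (T₂.funcCalc f (τ.rightVec ω)))
  rw [norm_sub_rev (inner ℂ η (T₂.funcCalc p (τ.rightVec ω)))] at h5
  linarith

/-- The witness of spectral closeness is reused unchanged. The second half of the Hausdorff distance
is the first one for the reversed tunnel, with the two maps of the iso-iso exchanged. -/
theorem operationalPropinquity_funcCalc_le {ε : ℝ} (hε : 0 < ε) (τ : Tunnel T₁.mcc T₂.mcc)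
    {ς₁ ς₂ : ℝ≥0 → ℝ≥0} (hς : IsIsoIso ε ς₁ ς₂) (hτ : τ.magnitude ς₁ ς₂ ε < ENNReal.ofReal ε)
    (f : ℝ →ᵇ ℂ) {δ : ℝ} (hδ : 0 ≤ δ) {ι : Type*} (s : Finset ι) (c : ι → ℂ) (t : ι → ℝ)
    (hf : ∀ x : ℝ, ‖(f - ∑ n ∈ s, c n • MetricSpectralTriple.expFun (t n)) x‖ ≤ δ * (1 + |x|))
    (ht : ∀ n ∈ s, 2 * |t n| ≤ 1 / ε) :
    operationalPropinquity (fun _ : Fin 1 => T₁.toAdjointable (T₁.funcCalc f))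
      (fun _ : Fin 1 => T₂.toAdjointable (T₂.funcCalc f)) ≤
      max (ENNReal.ofReal ε) (ENNReal.ofReal (4 * δ + 3 * ε * ∑ n ∈ s, ‖c n‖)) := by
  obtain ⟨h1, h2⟩ := max_lt_iff.1 hτ
  obtain ⟨h3, h4⟩ := max_lt_iff.1 h2
  refine (iInf_le _ τ).trans (max_le_max h1.le (max_le ?_ ?_))
  · exact τ.directedHausdorff_funcCalc_le hε (fun _ => hς.abs_left_sub_le hε) h3 f hδ s c t hf ht
  · exact τ.symm.directedHausdorff_funcCalc_le hε (fun _ => hς.symm.abs_left_sub_le hε) h4 f hδ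
      s c t hf ht

/-- Below `√2/2` the default value cannot be what makes the infimum small, so an actual tunnel
exists. -/
theorem exists_tunnel_of_spectralPropinquity_lt {r : ℝ} (hr : r ≤ √2 / 2)
    (h : spectralPropinquity T₁ T₂ < r) :
    ∃ ε : ℝ, 0 < ε ∧ ε < r ∧ ∃ (τ : Tunnel T₁.mcc T₂.mcc) (ς₁ ς₂ : ℝ≥0 → ℝ≥0),
      IsIsoIso ε ς₁ ς₂ ∧ τ.magnitude ς₁ ς₂ ε < ENNReal.ofReal ε := by
  obtain ⟨ε, hε, hεr⟩ := exists_lt_of_csInf_lt ⟨√2 / 2, Or.inl rfl⟩ h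
  rcases hε with hε | ⟨hε, hτ⟩
  · exact absurd (hε ▸ hεr) hr.not_gt
  · exact ⟨ε, hε, hεr, hτ⟩

end Comparison

/-! ### Convergence of the functional calculi -/

theorem mainTheorem3 (Λ : LeibnizConstants) (T : ℕ → MetricSpectralTriple.{u, v} Λ)
    (T_lim : MetricSpectralTriple.{u, v} Λ)
    (hT : Filter.Tendsto (fun n => spectralPropinquity (T n) T_lim) Filter.atTop (𝓝 0))
    (f : ℝ →ᵇ ℂ) :
    Filter.Tendsto
      (fun n => operationalPropinquity
        (fun _ : Fin 1 => (T n).toAdjointable ((T n).funcCalc f))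
        (fun _ : Fin 1 => T_lim.toAdjointable (T_lim.funcCalc f)))
      Filter.atTop (𝓝 0) := by
  rw [ENNReal.tendsto_nhds_zero]
  intro r hr
  obtain ⟨ρ, hρ, hρr⟩ := ENNReal.lt_iff_exists_nnreal_btwn.1 hr
  replace hρ : 0 < (ρ : ℝ) := by exact_mod_cast hρ
  -- With `δ = ρ/8` the approximation error `4δ` is `ρ/2`. The polynomial is fixed before the index
  -- `n`.
  obtain ⟨s, c, t, hf⟩ := exists_sum_expFun_approx f (show 0 < (ρ : ℝ) / 8 by positivity)
  set C : ℝ := 1 + ∑ n ∈ s, ‖c n‖ + ∑ n ∈ s, |t n| with hC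
  have hc0 : 0 ≤ ∑ n ∈ s, ‖c n‖ := Finset.sum_nonneg fun _ _ => norm_nonneg _
  have ht0 : 0 ≤ ∑ n ∈ s, |t n| := Finset.sum_nonneg fun _ _ => abs_nonneg _
  have hC0 : 0 < C := by linarith
  -- The three bounds serve in turn to exclude the default `√2/2`, to get `3ε ∑ |c_n| ≤ ρ/2` and `ε
  -- ≤ ρ` (as `C ≥ 1`), and to bring all frequencies into the range `2|t_k| ≤ 1/ε`.
  have hε₀ : 0 < min (√2 / 2) (min (ρ / (6 * C)) (1 / (2 * C))) := by positivity
  filter_upwards [hT.eventually_lt_const hε₀] with n hn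
  obtain ⟨ε, hε, hεr, τ, ς₁, ς₂, hς, hτ⟩ :=
    exists_tunnel_of_spectralPropinquity_lt (min_le_left _ _) hn
  obtain ⟨-, hε2⟩ := lt_min_iff.1 hεr
  obtain ⟨hε3, hε4⟩ := lt_min_iff.1 hε2
  rw [lt_div_iff₀ (by positivity)] at hε3 hε4
  have htε : ∀ k ∈ s, 2 * |t k| ≤ 1 / ε := fun k hk => by
    have h1 : |t k| ≤ ∑ n ∈ s, |t n| :=
      Finset.single_le_sum (f := fun n => |t n|) (fun _ _ => abs_nonneg _) hk
    rw [le_div_iff₀ hε]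
    have h2 : |t k| * ε ≤ C * ε := by
      gcongr
      linarith
    linarith
  have hεC : ε * ∑ n ∈ s, ‖c n‖ ≤ ε * C := by
    gcongr
    linarith
  have hεC1 : ε * 1 ≤ ε * C := by
    gcongr
    linarith
  have key := operationalPropinquity_funcCalc_le hε τ hς hτ f (by positivity) s c t hf htε
  refine key.trans (le_trans (max_le ?_ ?_) hρr.le)
  · rw [← ENNReal.ofReal_coe_nnreal]
    exact ENNReal.ofReal_le_ofReal (by linarith)
  · rw [← ENNReal.ofReal_coe_nnreal]
    exact ENNReal.ofReal_le_ofReal (by linarith)
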